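/- For $k\ge 0$ write $(x;q)_k=(1-x)(1-xq)\cdots(1-xq^{k-1})$ (so $(x;q)_0=1$), $(x_1,\dots,x_m;q)_k=(x_1;q)_k\cdots(x_m;q)_k$ and $[n]=1+q+\cdots+q^{n-1}$, and let $\Phi_n(q)$ be the $n$-th cyclotomic polynomial. For rational functions $A,B$ with rational coefficients and a nonzero polynomial $M$ (in the indeterminate $q$, or in the indeterminates $a,q$), $A\equiv B\pmod M$ means that $A-B=MU/V$ with polynomials $U$, $V\neq 0$ such that $V$ and $M$ have no nonconstant common factor. Let $n$ be a positive odd integer. (i) If $n>1$ and $c_q(k)=(-1)^k[3k+1]\dfrac{(q;q^2)_k^3}{(q;q)_k^3}$ for $k\ge 0$, then $$\sum_{k=0}^{n-1}\sum_{j=0}^{k}c_q(j)c_q(k-j)\equiv q^{(n+1)/2}[n]^2\pmod{[n]\Phi_n(q)^2}.$$ (ii) If $c_q(k)=(-1)^k[3k+1]\dfrac{(aq,q/a,q;q^2)_k}{(aq,q/a,q;q)_k}$ for $k\ge 0$, with a further indeterminate $a$, then $$\sum_{k=0}^{n-1}\sum_{j=0}^{k}c_q(j)c_q(k-j)\equiv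 q^{(n-1)^2/2}[n]^2\pmod{[n](1-aq^n)(a-q^n)}.$$ -/

import Mathlib

/-- The `q`-shifted factorial `(x; q)_k = (1 - x)(1 - x q) ⋯ (1 - x q^(k-1))`. -/
def qShifted {K : Type*} [CommRing K] (x q : K) (k : ℕ) : K :=
  ∏ i ∈ Finset.range k, (1 - x * q ^ i)

/-- The `q`-integer `[n] = 1 + q + ⋯ + q^(n-1)`. -/
def qInteger {K : Type*} [CommRing K] (q : K) (n : ℕ) : K :=
  ∑ i ∈ Finset.range n, q ^ i

/-- `c_q(k) = (-1)^k [3k+1] (q;q^2)_k^3 / (q;q)_k^3`. -/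
def cTerm {K : Type*} [Field K] (q : K) (k : ℕ) : K :=
  (-1) ^ k * qInteger q (3 * k + 1) * (qShifted q (q ^ 2) k ^ 3 / qShifted q q k ^ 3)

/-- `(-1)^k [3k+1] (aq, q/a, q; q^2)_k / (aq, q/a, q; q)_k`. -/
def cTermParam {K : Type*} [Field K] (a q : K) (k : ℕ) : K :=
  (-1) ^ k * qInteger q (3 * k + 1) *
    ((qShifted (a * q) (q ^ 2) k * qShifted (q / a) (q ^ 2) k * qShifted q (q ^ 2) k) /
      (qShifted (a * q) q k * qShifted (q / a) q k * qShifted q q k))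

/-- The truncated square `∑_{k=0}^{n-1} ∑_{j=0}^{k} c(j) c(k-j)`. -/
def truncSquare {K : Type*} [CommRing K] (c : ℕ → K) (n : ℕ) : K :=
  ∑ k ∈ Finset.range n, ∑ j ∈ Finset.range (k + 1), c j * c (k - j)

/-- Congruence of fractions modulo an element `m` of the ring `R`, for `K` the fraction field
of `R`: the difference is `m u / v` with `u v : R` and `v` without common factor with `m`. -/
def FracCongr {R K : Type*} [CommRing R] [Field K] [Algebra R K] (m : R) (x y : K) : Prop :=
  ∃ u v : R, v ≠ 0 ∧ IsRelPrime v m ∧ x - y = algebraMap R K (m * u) / algebraMap R K v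

/-- The ring of polynomials in two indeterminates `q` (inner) and `a` (outer). -/
abbrev PolyQA : Type := Polynomial (Polynomial ℚ)

/-- The indeterminate `q` of `PolyQA`. -/
noncomputable def varQ : PolyQA := Polynomial.C Polynomial.X

/-- The indeterminate `a` of `PolyQA`. -/
noncomputable def varA : PolyQA := Polynomial.X

/-- The field of rational functions in `q` and `a`. -/
abbrev RatQA : Type := FractionRing PolyQA

/-! ### Shifted factorials and q-integers -/

section Basic
variable {K : Type*} [CommRing K]

/-! Put the difference of the two sides in lowest terms. The congruence then says that the modulus
divides the numerator, so it is enough to treat pairwise coprime factors of the modulus one at a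
time. Each factor is tested by a specialisation under which the difference takes the value 0
(`map_num_eq_zero`).

The analytic input is one telescoping relation, `sum_contiguous`, between the sums with parameters
a/q² and a. Write n = 2m+1. At a = q^(-n) the boundary term vanishes, and induction on m gives the
terminating sum (-1)^m q^(m²) [n] (`sum_cTermParam_inv_pow`). If q is a primitive n-th root of unity
the boundary term vanishes for every admissible a, and n shifts bring a back to itself with a
contradictory factor, so the sum is 0 (`sum_cTermParam_primitiveRoot`).

For (ii), at a = q^n or a = q^(-n) the terms beyond m vanish, so the truncated square is the full
square of the terminating sum. At Φ_d with d ∣ n and d > 1, the summand is, on blocks of length d, a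
multiple of one block of sum 0 supported on its first half, so the truncated square vanishes
(`truncSquare_eq_zero_of_blocks`).

For (i), the factors Φ_d go the same way, and Φ_n³ is new. Modulo Φ_n² the parameter 1 may be
replaced by q^n, which evaluates the sum S over k ≤ m. Modulo Φ_n³ the terms with m < k < n vanish,
so the truncated square is S². As Φ_n ∣ [n], knowing S modulo Φ_n² determines S² modulo Φ_n³. -/

theorem qShifted_zero (x q : K) : qShifted x q 0 = 1 := by simp [qShifted]

theorem qShifted_succ (x q : K) (k : ℕ) :
    qShifted x q (k + 1) = qShifted x q k * (1 - x * q ^ k) := by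
  simp [qShifted, Finset.prod_range_succ]

theorem qInteger_mul_one_sub (q : K) (n : ℕ) : qInteger q n * (1 - q) = 1 - q ^ n :=
  geom_sum_mul_neg q n

theorem qShifted_ne_zero {F : Type*} [Field F] {x q : F} {k : ℕ}
    (h : ∀ i < k, x * q ^ i ≠ 1) : qShifted x q k ≠ 0 := by
  rw [qShifted, Finset.prod_ne_zero_iff]
  intro i hi
  exact sub_ne_zero.2 (h i (Finset.mem_range.1 hi)).symm

end Basic

/-! ### The contiguous relation a/q² ↔ a -/

section Telescoping
variable {F : Type*} [Field F]

/-- The summand `cTermParam` without its factor `[3k+1]`. -/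
def cRatio (a q : F) (k : ℕ) : F :=
  (-1) ^ k *
    ((qShifted (a * q) (q ^ 2) k * qShifted (q / a) (q ^ 2) k * qShifted q (q ^ 2) k) /
      (qShifted (a * q) q k * qShifted (q / a) q k * qShifted q q k))

theorem cTermParam_eq (a q : F) (k : ℕ) :
    cTermParam a q k = qInteger q (3 * k + 1) * cRatio a q k := by
  unfold cTermParam cRatio; ring

theorem cRatio_zero (a q : F) : cRatio a q 0 = 1 := by
  simp [cRatio, qShifted_zero]

theorem cTermParam_zero (a q : F) : cTermParam a q 0 = 1 := by
  simp [cTermParam_eq, cRatio_zero, qInteger]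

theorem cRatio_succ (a q : F) (ha : a ≠ 0) (k : ℕ) :
    cRatio a q (k + 1) = cRatio a q k *
      (-((1 - a * q * (q ^ k) ^ 2) * (a - q * (q ^ k) ^ 2) * (1 - q * (q ^ k) ^ 2)) /
        ((1 - a * q * q ^ k) * (a - q * q ^ k) * (1 - q * q ^ k))) := by
  have h1 : (1 - q / a * (q ^ 2) ^ k) = (a - q * (q ^ k) ^ 2) / a := by
    field_simp; ring
  have h2 : (1 - q / a * q ^ k) = (a - q * q ^ k) / a := by
    field_simp
  have h3 : (q ^ 2) ^ k = (q ^ k) ^ 2 := by ring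
  simp only [cRatio, qShifted_succ, h1, h2]
  rw [h3]
  generalize q ^ k = Q
  have e : ∀ A B C A' B' C' x y z x' y' z' : F, (A * x * (B * (y / a)) * (C * z)) /
      (A' * x' * (B' * (y' / a)) * (C' * z')) =
      (A * B * C) / (A' * B' * C') * ((x * y * z) / (x' * y' * z')) := by
    intros
    rw [div_mul_div_comm, show ∀ A B C x y z : F, A * x * (B * (y / a)) * (C * z) =
      (A * B * C * (x * y * z)) / a by intros; ring,
      show ∀ A B C x y z : F, A * x * (B * (y / a)) * (C * z) =
      (A * B * C * (x * y * z)) / a by intros; ring]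
    exact div_div_div_cancel_right₀ ha _ _
  rw [e]
  ring

/-- The shift `a ↦ a / q²` in terms of the preceding term. -/
theorem cRatio_shift (a q : F) (ha : a ≠ 0) (hq : q ≠ 0) (N : ℕ)
    (h1 : ∀ i ≤ N, a * q ^ i ≠ 1) (h2 : ∀ i ≤ N + 2, a ≠ q ^ (i + 1))
    (h3 : ∀ i ≤ N, q ^ (i + 1) ≠ 1) :
    cRatio (a / q ^ 2) q (N + 1) = cRatio a q N *
      (-((a - q * (q ^ N) ^ 2) * (a - q ^ 3 * (q ^ N) ^ 2) * (a - q ^ 2) *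
          (1 - q * (q ^ N) ^ 2) * (1 - a * q ^ N)) /
        ((1 - q * q ^ N) * (1 - a) * (a - q * q ^ N) * (a - q ^ 2 * q ^ N) *
          (a - q ^ 3 * q ^ N))) := by
  have g0 : 1 - a ≠ 0 := sub_ne_zero.2 fun h => h1 0 (Nat.zero_le _) (by simpa using h.symm)
  have g1 : a - q ≠ 0 := sub_ne_zero.2 (by simpa using h2 0 (by omega))
  induction N with
  | zero =>
    have g2 : a - q ^ 2 ≠ 0 := sub_ne_zero.2 (h2 1 (by omega))
    have g3 : a - q ^ 3 ≠ 0 := sub_ne_zero.2 (h2 2 (by omega))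
    have g4 : 1 - q ≠ 0 := sub_ne_zero.2 fun h => h3 0 le_rfl (by simpa using h.symm)
    have g5 : q - a ≠ 0 := sub_ne_zero.2 (sub_ne_zero.1 g1).symm
    rw [cRatio_succ _ _ (div_ne_zero ha (pow_ne_zero 2 hq)), cRatio_zero, cRatio_zero]
    simp only [pow_zero, mul_one, one_pow]
    have e1 : 1 - a / q ^ 2 * q = (q - a) / q := by field_simp
    have e2 : a / q ^ 2 - q = (a - q ^ 3) / q ^ 2 := by field_simp
    rw [e1, e2]
    field_simp
  | succ N ih =>
    rw [cRatio_succ _ _ (div_ne_zero ha (pow_ne_zero 2 hq)), ih (fun i hi => h1 i (by omega))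
      (fun i hi => h2 i (by omega)) (fun i hi => h3 i (by omega)), cRatio_succ _ _ ha]
    have k1 : 1 - a * q ^ N ≠ 0 := sub_ne_zero.2 (h1 N (by omega)).symm
    have k2 : 1 - a * q * q ^ N ≠ 0 := by
      have := h1 (N + 1) le_rfl
      rw [mul_assoc, ← pow_succ']
      exact sub_ne_zero.2 this.symm
    have k3 : 1 - q * q ^ N ≠ 0 := by
      rw [← pow_succ']; exact sub_ne_zero.2 (h3 N (by omega)).symm
    have k4 : 1 - q ^ 2 * q ^ N ≠ 0 := by
      rw [← pow_add, add_comm]; exact sub_ne_zero.2 (h3 (N + 1) (by omega)).symm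
    have k5 : a - q * q ^ N ≠ 0 := by
      rw [← pow_succ']; exact sub_ne_zero.2 (h2 N (by omega))
    have k6 : a - q ^ 2 * q ^ N ≠ 0 := by
      rw [← pow_add, add_comm]; exact sub_ne_zero.2 (h2 (N + 1) (by omega))
    have k7 : a - q ^ 3 * q ^ N ≠ 0 := by
      rw [← pow_add, add_comm]; exact sub_ne_zero.2 (h2 (N + 2) (by omega))
    have k8 : a - q ^ 4 * q ^ N ≠ 0 := by
      rw [← pow_add, add_comm]; exact sub_ne_zero.2 (h2 (N + 3) (by omega))
    rw [pow_succ q N]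
    generalize q ^ N = Q at *
    generalize cRatio a q N = t
    have e1 : 1 - a / q ^ 2 * q * (Q * q) ^ 2 = 1 - a * q * Q ^ 2 := by field_simp
    have e2 : a / q ^ 2 - q * (Q * q) ^ 2 = (a - q ^ 5 * Q ^ 2) / q ^ 2 := by field_simp
    have e3 : 1 - a / q ^ 2 * q * (Q * q) = 1 - a * Q := by field_simp
    have e4 : a / q ^ 2 - q * (Q * q) = (a - q ^ 4 * Q) / q ^ 2 := by field_simp
    have e5 : 1 - q * (Q * q) = 1 - q ^ 2 * Q := by ring
    have e6 : a - q * (Q * q) = a - q ^ 2 * Q := by ring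
    have e7 : a - q ^ 2 * (Q * q) = a - q ^ 3 * Q := by ring
    have e8 : a - q ^ 3 * (Q * q) = a - q ^ 4 * Q := by ring
    rw [e1, e2, e3, e4, e5, e6, e7, e8]
    field_simp

/-- Partial sums of the contiguous relation between the sums with parameters `a / q²` and `a`. -/
theorem sum_contiguous (a q : F) (ha : a ≠ 0) (hq : q ≠ 0) (N : ℕ)
    (h1 : ∀ i ≤ N, a * q ^ i ≠ 1) (h2 : ∀ i ≤ N + 2, a ≠ q ^ (i + 1))
    (h3 : ∀ i ≤ N, q ^ (i + 1) ≠ 1) :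
    ∑ k ∈ Finset.range (N + 1),
        ((a - 1) * a * cTermParam (a / q ^ 2) q k + (a - q ^ 2) * cTermParam a q k) =
      cRatio a q N * ((a - q ^ 2) * (a ^ 2 - q ^ 2) * (a - q * (q ^ N) ^ 2) *
        (1 - q * (q ^ N) ^ 2) * q ^ N / ((1 - q) * (a - q * q ^ N) * (a - q ^ 2 * q ^ N))) := by
  have g0 : 1 - a ≠ 0 := sub_ne_zero.2 fun h => h1 0 (Nat.zero_le _) (by simpa using h.symm)
  have g1 : a - q ≠ 0 := sub_ne_zero.2 (by simpa using h2 0 (by omega))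
  have g2 : a - q ^ 2 ≠ 0 := sub_ne_zero.2 (h2 1 (by omega))
  have g4 : 1 - q ≠ 0 := sub_ne_zero.2 fun h => h3 0 (Nat.zero_le _) (by simpa using h.symm)
  -- The right side is a telescoping certificate, so only its increments need checking. Two of its
  -- factors matter later: `cRatio a q N`, zero once the sum has terminated, and 1 - q^(2N+1), zero
  -- at roots of unity of order 2N+1.
  induction N with
  | zero =>
    simp only [zero_add, Finset.sum_range_one, cTermParam_zero, cRatio_zero, pow_zero]
    field_simp
    ring
  | succ N ih =>
    rw [Finset.sum_range_succ, ih (fun i hi => h1 i (by omega))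
      (fun i hi => h2 i (by omega)) (fun i hi => h3 i (by omega)), cTermParam_eq, cTermParam_eq,
      cRatio_shift a q ha hq N (fun i hi => h1 i (by omega))
      (fun i hi => h2 i (by omega)) (fun i hi => h3 i (by omega)), cRatio_succ _ _ ha]
    have k1 : 1 - a * q ^ N ≠ 0 := sub_ne_zero.2 (h1 N (by omega)).symm
    have k2 : 1 - a * q * q ^ N ≠ 0 := by
      have := h1 (N + 1) le_rfl
      rw [mul_assoc, ← pow_succ']
      exact sub_ne_zero.2 this.symm
    have k3 : 1 - q * q ^ N ≠ 0 := by
      rw [← pow_succ']; exact sub_ne_zero.2 (h3 N (by omega)).symm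
    have k5 : a - q * q ^ N ≠ 0 := by
      rw [← pow_succ']; exact sub_ne_zero.2 (h2 N (by omega))
    have k6 : a - q ^ 2 * q ^ N ≠ 0 := by
      rw [← pow_add, add_comm]; exact sub_ne_zero.2 (h2 (N + 1) (by omega))
    have k7 : a - q ^ 3 * q ^ N ≠ 0 := by
      rw [← pow_add, add_comm]; exact sub_ne_zero.2 (h2 (N + 2) (by omega))
    have e0 : qInteger q (3 * (N + 1) + 1) = (1 - q ^ 4 * (q ^ N) ^ 3) / (1 - q) := by
      rw [eq_div_iff g4, qInteger_mul_one_sub]; ring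
    rw [e0, pow_succ q N]
    generalize q ^ N = Q at *
    generalize cRatio a q N = t
    have e6 : a - q * (Q * q) = a - q ^ 2 * Q := by ring
    have e7 : a - q ^ 2 * (Q * q) = a - q ^ 3 * Q := by ring
    rw [e6, e7]
    have e8 : (a - 1) = -(1 - a) := by ring
    rw [e8]
    field_simp
    ring

end Telescoping


/-! ### Terminating sums and sums at roots of unity -/

section Evaluations
variable {F : Type*} [Field F]

theorem cRatio_eq_zero {a q : F} {k i : ℕ} (hi : i < k)
    (h : a * q * (q ^ 2) ^ i = 1 ∨ q / a * (q ^ 2) ^ i = 1 ∨ q * (q ^ 2) ^ i = 1) :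
    cRatio a q k = 0 := by
  have key : ∀ x : F, x * (q ^ 2) ^ i = 1 → qShifted x (q ^ 2) k = 0 := fun x hx =>
    Finset.prod_eq_zero (Finset.mem_range.2 hi) (by rw [hx, sub_self])
  rcases h with h | h | h <;> simp [cRatio, key _ h]

/-- For a = q^(-(2m+1)) the factor 1 - aq·q^(2m) kills the boundary term at N = m+1, so the
contiguous relation becomes a two-term recursion from m to m+1. -/
theorem sum_cTermParam_inv_pow (q : F) (hq : q ≠ 0) (hq1 : ∀ i, q ^ (i + 1) ≠ 1) (m : ℕ) :
    ∑ k ∈ Finset.range (m + 1), cTermParam ((q ^ (2 * m + 1))⁻¹) q k =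
      (-1) ^ m * q ^ (m ^ 2) * qInteger q (2 * m + 1) := by
  have hpow : ∀ i j : ℕ, i ≠ j → q ^ i ≠ q ^ j := by
    have aux : ∀ i j : ℕ, i < j → q ^ i ≠ q ^ j := by
      intro i j hij h
      obtain ⟨t, rfl⟩ := Nat.exists_eq_add_of_lt hij
      apply hq1 t
      have : q ^ i * q ^ (t + 1) = q ^ i * 1 := by rw [mul_one, ← pow_add, h]; ring
      exact mul_left_cancel₀ (pow_ne_zero i hq) this
    intro i j hij
    rcases lt_or_gt_of_ne hij with h | h
    · exact aux i j h
    · exact (aux j i h).symm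
  have g4 : 1 - q ≠ 0 := sub_ne_zero.2 fun h => hq1 0 (by simpa using h.symm)
  induction m with
  | zero => simp [cTermParam_zero, qInteger]
  | succ m ih =>
    -- The step from m = 0 is done by hand: there a = q^(-1), and aq = 1 violates the nonvanishing
    -- conditions of the contiguous relation.
    rcases Nat.eq_zero_or_pos m with rfl | hm
    · have c1 : cRatio ((q ^ (2 * (0 + 1) + 1))⁻¹) q 1 = -1 := by
        have h1 : (1 - (q ^ 3)⁻¹ * q) ≠ 0 := by
          have := hpow 3 1 (by norm_num)
          rw [sub_ne_zero]; intro h; apply this; field_simp at h ⊢; simpa using h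
        have h2 : ((q ^ 3)⁻¹ - q) ≠ 0 := by
          have := hpow 0 4 (by norm_num)
          rw [sub_ne_zero]; intro h; apply this; field_simp at h ⊢; simpa using h
        rw [cRatio_succ _ _ (by positivity), cRatio_zero]
        simp only [pow_zero, mul_one, one_pow, zero_add, one_mul, Nat.reduceAdd]
        rw [neg_div, div_self]
        exact mul_ne_zero (mul_ne_zero h1 h2) g4
      rw [Finset.sum_range_succ, Finset.sum_range_one, cTermParam_zero, cTermParam_eq, c1]
      simp [qInteger, Finset.sum_range_succ]
      ring
    · set a : F := (q ^ (2 * m + 1))⁻¹ with ha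
      have hA : q ^ (2 * m + 1) ≠ 0 := pow_ne_zero _ hq
      have ha0 : a ≠ 0 := inv_ne_zero hA
      have h1 : ∀ i ≤ m + 1, a * q ^ i ≠ 1 := by
        intro i hi h
        apply hpow i (2 * m + 1) (by omega)
        rw [ha] at h; field_simp at h; exact h
      have h2 : ∀ i, a ≠ q ^ (i + 1) := by
        intro i h
        apply hq1 (i + 1 + 2 * m)
        rw [ha] at h; field_simp at h; rw [h]; ring
      have S := sum_contiguous a q ha0 hq (m + 1) h1 (fun i _ => h2 i) (fun i _ => hq1 i)
      have hz : cRatio a q (m + 1) = 0 := by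
        apply cRatio_eq_zero (Nat.lt_succ_self m)
        left
        rw [ha]; field_simp; ring
      have ha' : a / q ^ 2 = (q ^ (2 * (m + 1) + 1))⁻¹ := by
        rw [ha]; field_simp; ring
      rw [hz, zero_mul, Finset.sum_add_distrib, ← Finset.mul_sum, ← Finset.mul_sum,
        Finset.sum_range_succ (fun k => cTermParam a q k), cTermParam_eq a q (m + 1), hz,
        mul_zero, add_zero, ih, ha'] at S
      have hb : (a - 1) * a ≠ 0 :=
        mul_ne_zero (sub_ne_zero.2 (by simpa using h1 0 (Nat.zero_le _))) ha0
      apply mul_left_cancel₀ hb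
      rw [eq_neg_of_add_eq_zero_left S]
      apply mul_right_cancel₀ g4
      have e1 := qInteger_mul_one_sub q (2 * m + 1)
      have e2 := qInteger_mul_one_sub q (2 * (m + 1) + 1)
      have e3 : a * q ^ (2 * m + 1) = 1 := by rw [ha]; field_simp
      have : -((a - q ^ 2) * ((-1) ^ m * q ^ m ^ 2 * qInteger q (2 * m + 1))) * (1 - q)
          = -((a - q ^ 2) * ((-1) ^ m * q ^ m ^ 2 * (1 - q ^ (2 * m + 1)))) := by
        rw [← e1]; ring
      rw [this]
      have : (a - 1) * a * ((-1) ^ (m + 1) * q ^ (m + 1) ^ 2 * qInteger q (2 * (m + 1) + 1)) *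
          (1 - q) = (a - 1) * a * ((-1) ^ (m + 1) * q ^ (m + 1) ^ 2 *
            (1 - q ^ (2 * (m + 1) + 1))) := by
        rw [← e2]; ring
      rw [this, show q ^ (m + 1) ^ 2 = q ^ m ^ 2 * q ^ (2 * m + 1) by rw [← pow_add]; ring_nf,
        show q ^ (2 * (m + 1) + 1) = q ^ 2 * q ^ (2 * m + 1) by rw [← pow_add]; ring_nf]
      generalize q ^ (2 * m + 1) = Q at *
      have hQ : Q = a⁻¹ := eq_inv_of_mul_eq_one_right e3
      rw [hQ]
      field_simp
      ring

/-- At a primitive root of unity of odd order the sum vanishes for all but finitely many values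
of the parameter. -/
theorem sum_cTermParam_primitiveRoot {z : F} {m : ℕ} (hz : IsPrimitiveRoot z (2 * m + 1))
    (hm : 0 < m) (a : F) (ha : a ≠ 0) (ha1 : a ^ (2 * m + 1) ≠ 1) (ha2 : a ^ (2 * m + 1) ≠ -1) :
    ∑ k ∈ Finset.range (m + 1), cTermParam a z k = 0 := by
  have hz0 : z ≠ 0 := hz.ne_zero (by omega)
  have hzp : ∀ i : ℕ, (z ^ i) ^ (2 * m + 1) = 1 := fun i => by
    rw [← pow_mul, mul_comm, pow_mul, hz.pow_eq_one, one_pow]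
  have key : ∀ b : F, b ≠ 0 → b ^ (2 * m + 1) ≠ 1 →
      (b - 1) * b * ∑ k ∈ Finset.range (m + 1), cTermParam (b / z ^ 2) z k =
        -(b - z ^ 2) * ∑ k ∈ Finset.range (m + 1), cTermParam b z k := by
    intro b hb hb1
    have S := sum_contiguous b z hb hz0 m
      (fun i _ h => hb1 (by
        have := congrArg (· ^ (2 * m + 1)) h
        simpa [mul_pow, hzp] using this))
      (fun i _ h => hb1 (by rw [h, hzp]))
      (fun i hi => hz.pow_ne_one_of_pos_of_lt (by omega) (by omega))
    -- The boundary factor 1 - q^(2N+1) at N = m becomes 1 - z^(2m+1), so the shift relation is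
    -- homogeneous.
    have hv : 1 - z * (z ^ m) ^ 2 = 0 := by
      rw [← hz.pow_eq_one]; ring
    rw [hv, Finset.sum_add_distrib, ← Finset.mul_sum, ← Finset.mul_sum] at S
    linear_combination S
  set U : F → F := fun b => ∑ k ∈ Finset.range (m + 1), cTermParam b z k with hU
  have hne : ∀ i, a / z ^ (2 * i) - 1 ≠ 0 := by
    intro i h
    apply ha1
    have : a = z ^ (2 * i) := by
      have := sub_eq_zero.1 h
      rwa [div_eq_one_iff_eq (pow_ne_zero _ hz0)] at this
    rw [this, hzp]
  -- With b = a/z^(2i), the factor b - z² equals z²(b/z² - 1), and b/z² - 1 cancels against the next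
  -- denominator; the product of the shift factors telescopes.
  have iter : ∀ i, U (a / z ^ (2 * i)) * (a - 1) * a ^ i =
      (-1) ^ i * z ^ (i * (i + 1)) * (a / z ^ (2 * i) - 1) * U a := by
    intro i
    induction i with
    | zero => simp; ring
    | succ i ih =>
      have k := key (a / z ^ (2 * i)) (div_ne_zero ha (pow_ne_zero _ hz0)) (by
        rw [div_pow, hzp, div_one]; exact ha1)
      have e : a / z ^ (2 * i) / z ^ 2 = a / z ^ (2 * (i + 1)) := by
        field_simp; ring
      rw [e] at k
      change _ * U _ = _ * U _ at k
      apply mul_left_cancel₀ (mul_ne_zero (hne i)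
        (div_ne_zero ha (pow_ne_zero (2 * i) hz0)))
      have : (a / z ^ (2 * i) - 1) * (a / z ^ (2 * i)) *
          (U (a / z ^ (2 * (i + 1))) * (a - 1) * a ^ (i + 1)) =
          -(a / z ^ (2 * i) - z ^ 2) * a * (U (a / z ^ (2 * i)) * (a - 1) * a ^ i) := by
        linear_combination (a - 1) * a ^ (i + 1) * k
      rw [this, ih, show z ^ ((i + 1) * (i + 1 + 1)) = z ^ (i * (i + 1)) * z ^ (2 * i) * z ^ 2 by
        rw [← pow_add, ← pow_add]; ring_nf,
        show z ^ (2 * (i + 1)) = z ^ (2 * i) * z ^ 2 by rw [← pow_add]; ring_nf]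
      have : z ^ (2 * i) ≠ 0 := pow_ne_zero _ hz0
      field_simp
      ring
  -- After 2m+1 shifts the parameter is a again, since z^(2(2m+1)) = 1, and the odd sign leaves (a -
  -- 1)(a^(2m+1) + 1) U(a) = 0.
  have fin := iter (2 * m + 1)
  rw [show z ^ (2 * (2 * m + 1)) = 1 by rw [mul_comm, pow_mul, hz.pow_eq_one, one_pow],
    show z ^ ((2 * m + 1) * (2 * m + 1 + 1)) = 1 by rw [pow_mul, hz.pow_eq_one, one_pow],
    Odd.neg_one_pow (⟨m, rfl⟩ : Odd (2 * m + 1)), div_one] at fin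
  have : (a - 1) * (a ^ (2 * m + 1) + 1) * U a = 0 := by linear_combination fin
  have h0 : a - 1 ≠ 0 := by simpa using hne 0
  rcases mul_eq_zero.1 this with h | h
  · rcases mul_eq_zero.1 h with h | h
    · exact absurd h h0
    · exact absurd (eq_neg_of_add_eq_zero_left h) ha2
  · exact h

end Evaluations


/-! ### Truncated squares -/

section TruncSquare
variable {A : Type*} [CommRing A]

theorem truncSquare_eq_sum_ite (c : ℕ → A) (n : ℕ) :
    truncSquare c n = ∑ i ∈ Finset.range n, ∑ j ∈ Finset.range n,
      if i + j < n then c i * c j else 0 := by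
  unfold truncSquare
  rw [← Finset.sum_product', Finset.sum_sigma', ← Finset.sum_filter]
  refine Finset.sum_bij' (fun x _ => (x.2, x.1 - x.2)) (fun y _ => ⟨y.1 + y.2, y.1⟩) ?_ ?_ ?_ ?_ ?_
  · rintro ⟨k, j⟩ h
    simp only [Finset.mem_sigma, Finset.mem_range, Finset.mem_filter, Finset.mem_product] at h ⊢
    omega
  · rintro ⟨i, j⟩ h
    simp only [Finset.mem_sigma, Finset.mem_range, Finset.mem_filter, Finset.mem_product] at h ⊢
    omega
  · rintro ⟨k, j⟩ h
    simp only [Finset.mem_sigma, Finset.mem_range] at h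
    simp only [Sigma.mk.injEq, heq_eq_eq, and_true]
    omega
  · rintro ⟨i, j⟩ h
    simp
  · rintro ⟨k, j⟩ h
    rfl

/-- Indices i, j ≤ m always satisfy i + j < 2m+1, so the truncation removes nothing. -/
theorem truncSquare_of_eq_zero {c : ℕ → A} {m : ℕ} (h : ∀ k, m < k → k < 2 * m + 1 → c k = 0) :
    truncSquare c (2 * m + 1) = (∑ k ∈ Finset.range (m + 1), c k) ^ 2 := by
  have hs : ∀ f : ℕ → A, (∀ k, m < k → k < 2 * m + 1 → f k = 0) →
      ∑ k ∈ Finset.range (2 * m + 1), f k = ∑ k ∈ Finset.range (m + 1), f k := fun f hf =>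
    (Finset.sum_subset (Finset.range_subset_range.2 (by omega)) fun k hk hk' => hf k
      (by simpa using hk') (by simpa using hk)).symm
  rw [truncSquare_eq_sum_ite, hs, sq, Finset.sum_mul_sum]
  · refine Finset.sum_congr rfl fun i hi => ?_
    rw [hs]
    · refine Finset.sum_congr rfl fun j hj => if_pos ?_
      simp only [Finset.mem_range] at hi hj
      omega
    · intro k h1 h2
      simp [h k h1 h2]
  · intro k h1 h2
    simp [h k h1 h2]

theorem sum_range_mul_eq (f : ℕ → A) (d e : ℕ) :
    ∑ i ∈ Finset.range (d * e), f i =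
      ∑ l ∈ Finset.range e, ∑ k ∈ Finset.range d, f (d * l + k) := by
  induction e with
  | zero => simp
  | succ e ih => rw [Nat.mul_succ, Finset.sum_range_add, ih, Finset.sum_range_succ]

/-- A truncated square vanishes when the sequence is, blockwise, a multiple of a block supported
on its first half and of sum zero. -/
theorem truncSquare_eq_zero_of_blocks {z w C : ℕ → A} {m e : ℕ}
    (hz : ∀ l k, k < 2 * m + 1 → z ((2 * m + 1) * l + k) = C l * w k)
    (hw : ∀ k, m < k → k < 2 * m + 1 → w k = 0)
    (hs : ∑ k ∈ Finset.range (m + 1), w k = 0) :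
    truncSquare z ((2 * m + 1) * e) = 0 := by
  have hcong : ∀ l k l' k', k < 2 * m + 1 → k' < 2 * m + 1 →
      (if (2 * m + 1) * l + k + ((2 * m + 1) * l' + k') < (2 * m + 1) * e then
        z ((2 * m + 1) * l + k) * z ((2 * m + 1) * l' + k') else 0) =
      (if l + l' < e then C l * C l' else 0) * (w k * w k') := by
    intro l k l' k' hk hk'
    rw [hz l k hk, hz l' k' hk']
    by_cases h1 : m < k
    · simp [hw k h1 hk]
    by_cases h2 : m < k'
    · simp [hw k' h2 hk']
    -- Since k + k' ≤ 2m, adding the positions inside the blocks produces no carry, and the cut-off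
    -- sees only l + l'.
    have : (2 * m + 1) * l + k + ((2 * m + 1) * l' + k') < (2 * m + 1) * e ↔ l + l' < e := by
      have e1 : (2 * m + 1) * l + k + ((2 * m + 1) * l' + k') =
        (2 * m + 1) * (l + l') + (k + k') := by ring
      rw [e1]
      constructor
      · intro h
        by_contra h'
        have := Nat.mul_le_mul_left (2 * m + 1) (not_lt.1 h')
        omega
      · intro h
        have := Nat.mul_le_mul_left (2 * m + 1) (Nat.succ_le_of_lt h)
        rw [Nat.mul_succ] at this
        omega
    simp only [this]
    split_ifs <;> ring
  have hsum : ∑ k ∈ Finset.range (2 * m + 1), w k = 0 := by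
    rw [← hs]
    exact (Finset.sum_subset (Finset.range_subset_range.2 (by omega)) fun k hk hk' => hw k
      (by simpa using hk') (by simpa using hk)).symm
  rw [truncSquare_eq_sum_ite, sum_range_mul_eq]
  refine Finset.sum_eq_zero fun l _ => ?_
  rw [Finset.sum_congr rfl fun k _ => sum_range_mul_eq _ _ _, Finset.sum_comm]
  refine Finset.sum_eq_zero fun l' _ => ?_
  rw [Finset.sum_congr rfl fun k hk => Finset.sum_congr rfl fun k' hk' =>
    hcong l k l' k' (Finset.mem_range.1 hk) (Finset.mem_range.1 hk')]
  simp only [← Finset.mul_sum, hsum, mul_zero, Finset.sum_const_zero]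

end TruncSquare

/-! ### Values of fractions under a ring homomorphism -/

section EvalSubring
variable {R K L : Type*} [CommRing R] [Field K] [Algebra R K] [CommRing L]

/-- The graph of the extension of `φ : R → L` to the fractions whose denominator is mapped to
a unit. -/
def evalSubring (K : Type*) [Field K] [Algebra R K] (φ : R →+* L) : Subring (K × L) where
  carrier := {p | ∃ u v : R, IsUnit (φ v) ∧ p.1 * algebraMap R K v = algebraMap R K u ∧
    p.2 * φ v = φ u}
  mul_mem' := by
    rintro ⟨x, z⟩ ⟨y, w⟩ ⟨u, v, h1, h2, h3⟩ ⟨u', v', h1', h2', h3'⟩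
    refine ⟨u * u', v * v', by rw [map_mul]; exact h1.mul h1', ?_, ?_⟩
    · simp only [map_mul, Prod.mk_mul_mk, ← h2, ← h2']; ring
    · simp only [map_mul, Prod.mk_mul_mk, ← h3, ← h3']; ring
  one_mem' := ⟨1, 1, by simp, by simp, by simp⟩
  add_mem' := by
    rintro ⟨x, z⟩ ⟨y, w⟩ ⟨u, v, h1, h2, h3⟩ ⟨u', v', h1', h2', h3'⟩
    refine ⟨u * v' + u' * v, v * v', by rw [map_mul]; exact h1.mul h1', ?_, ?_⟩
    · simp only [map_mul, map_add, Prod.mk_add_mk, ← h2, ← h2']; ring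
    · simp only [map_mul, map_add, Prod.mk_add_mk, ← h3, ← h3']; ring
  zero_mem' := ⟨0, 1, by simp, by simp, by simp⟩
  neg_mem' := by
    rintro ⟨x, z⟩ ⟨u, v, h1, h2, h3⟩
    refine ⟨-u, v, h1, ?_, ?_⟩
    · simp only [map_neg, Prod.neg_mk, ← h2]; ring
    · simp only [map_neg, Prod.neg_mk, ← h3]; ring

variable {φ : R →+* L}

theorem algebraMap_mem_evalSubring (r : R) : (algebraMap R K r, φ r) ∈ evalSubring K φ :=
  ⟨r, 1, by simp, by simp, by simp⟩

theorem inv_mem_evalSubring [FaithfulSMul R K] [Nontrivial L] {x : K} {z : L}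
    (h : (x, z) ∈ evalSubring K φ) (hz : IsUnit z) :
    (x⁻¹, Ring.inverse z) ∈ evalSubring K φ := by
  obtain ⟨u, v, h1, h2, h3⟩ := h
  dsimp only at h2 h3
  have hu : IsUnit (φ u) := by rw [← h3]; exact hz.mul h1
  refine ⟨v, u, hu, ?_, ?_⟩
  · have hx : x ≠ 0 := by
      rintro rfl
      rw [zero_mul, eq_comm, FaithfulSMul.algebraMap_eq_zero_iff] at h2
      rw [h2, map_zero] at hu
      exact not_isUnit_zero hu
    dsimp only
    rw [← h2, inv_mul_cancel_left₀ hx]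
  · dsimp only
    rw [← h3, Ring.inverse_mul_cancel_left _ _ hz]

/-- The value of a fraction is well defined, so an identity between fractions passes to their
values. -/
theorem evalSubring_unique [FaithfulSMul R K] {x : K} {z w : L}
    (h : (x, z) ∈ evalSubring K φ) (h' : (x, w) ∈ evalSubring K φ) : z = w := by
  have h0 := (evalSubring K φ).sub_mem h h'
  obtain ⟨u, v, h1, h2, h3⟩ := h0
  simp only [Prod.mk_sub_mk, sub_self, zero_mul] at h2 h3
  rw [eq_comm, FaithfulSMul.algebraMap_eq_zero_iff] at h2
  rw [h2, map_zero] at h3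
  exact sub_eq_zero.1 ((h1.mul_left_eq_zero).1 h3)

theorem mul_mem_evalSubring {x y : K} {z w : L} (h : (x, z) ∈ evalSubring K φ)
    (h' : (y, w) ∈ evalSubring K φ) : (x * y, z * w) ∈ evalSubring K φ :=
  (evalSubring K φ).mul_mem h h'

theorem neg_one_mem_evalSubring : ((-1 : K), (-1 : L)) ∈ evalSubring K φ :=
  (evalSubring K φ).neg_mem (evalSubring K φ).one_mem

theorem sum_mem_evalSubring {ι : Type*} {s : Finset ι} {f : ι → K} {g : ι → L}
    (h : ∀ i ∈ s, (f i, g i) ∈ evalSubring K φ) :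
    (∑ i ∈ s, f i, ∑ i ∈ s, g i) ∈ evalSubring K φ := by
  have := (evalSubring K φ).sum_mem h
  rwa [← prod_mk_sum] at this

theorem prod_mem_evalSubring {ι : Type*} {s : Finset ι} {f : ι → K} {g : ι → L}
    (h : ∀ i ∈ s, (f i, g i) ∈ evalSubring K φ) :
    (∏ i ∈ s, f i, ∏ i ∈ s, g i) ∈ evalSubring K φ := by
  have := (evalSubring K φ).prod_mem h
  rwa [← prod_mk_prod] at this

theorem truncSquare_mem_evalSubring {f : ℕ → K} {g : ℕ → L} {n : ℕ}
    (h : ∀ i < n, (f i, g i) ∈ evalSubring K φ) :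
    (truncSquare f n, truncSquare g n) ∈ evalSubring K φ := by
  refine sum_mem_evalSubring fun k hk => sum_mem_evalSubring fun j hj => ?_
  rw [Finset.mem_range] at hk hj
  exact (evalSubring K φ).mul_mem (h j (by omega)) (h (k - j) (by omega))

theorem pow_mem_evalSubring {x : K} {z : L} (h : (x, z) ∈ evalSubring K φ) (n : ℕ) :
    (x ^ n, z ^ n) ∈ evalSubring K φ :=
  (evalSubring K φ).pow_mem h n

theorem qInteger_mem_evalSubring {x : K} {z : L} (h : (x, z) ∈ evalSubring K φ) (n : ℕ) :
    (qInteger x n, qInteger z n) ∈ evalSubring K φ :=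
  sum_mem_evalSubring fun i _ => pow_mem_evalSubring h i

theorem one_sub_mem_evalSubring {x : K} {z : L} (h : (x, z) ∈ evalSubring K φ) :
    (1 - x, 1 - z) ∈ evalSubring K φ :=
  (evalSubring K φ).sub_mem (evalSubring K φ).one_mem h

theorem qShifted_mem_evalSubring {x q : K} {z w : L} (h : (x, z) ∈ evalSubring K φ)
    (hq : (q, w) ∈ evalSubring K φ) (n : ℕ) :
    (qShifted x q n, qShifted z w n) ∈ evalSubring K φ :=
  prod_mem_evalSubring fun i _ => one_sub_mem_evalSubring
    ((evalSubring K φ).mul_mem h (pow_mem_evalSubring hq i))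

end EvalSubring


/-! ### Factorisation of the summand and its periodicity -/

section PRatio
variable {F : Type*} [Field F]

/-- The quotient `(xq; q²)_k / (xq; q)_k`. -/
def pRatio (x q : F) (k : ℕ) : F := qShifted (x * q) (q ^ 2) k / qShifted (x * q) q k

theorem cTermParam_eq_pRatio (a q : F) (k : ℕ) :
    cTermParam a q k = (-1) ^ k * qInteger q (3 * k + 1) *
      (pRatio a q k * pRatio a⁻¹ q k * pRatio 1 q k) := by
  simp only [cTermParam, pRatio, one_mul, div_eq_mul_inv q a, mul_comm q a⁻¹,
    div_mul_div_comm]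

theorem cTerm_eq_cTermParam (q : F) (k : ℕ) : cTerm q k = cTermParam 1 q k := by
  rw [cTermParam_eq_pRatio, cTerm, inv_one]
  simp only [pRatio, one_mul, div_mul_div_comm]
  congr 2 <;> ring

theorem pRatio_one_eq_prod (q : F) (k : ℕ) :
    pRatio 1 q k = ∏ i ∈ Finset.range k, (1 - q ^ (2 * i + 1)) / (1 - q ^ (i + 1)) := by
  rw [pRatio, qShifted, qShifted, ← Finset.prod_div_distrib]
  refine Finset.prod_congr rfl fun i _ => ?_
  ring_nf

theorem qShifted_mul_add {A : Type*} [CommRing A] (x : A) {q : A} {d : ℕ} (hq : q ^ d = 1)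
    (l k : ℕ) : qShifted x q (d * l + k) = qShifted x q d ^ l * qShifted x q k := by
  have h1 : ∀ k, qShifted x q (d + k) = qShifted x q d * qShifted x q k := by
    intro k
    simp only [qShifted, Finset.prod_range_add, pow_add, hq, one_mul]
  induction l with
  | zero => simp
  | succ l ih =>
    rw [show d * (l + 1) + k = d + (d * l + k) by ring, h1, ih]
    ring

theorem pRatio_mul_add (x : F) {q : F} {d : ℕ} (hq : q ^ d = 1) (l k : ℕ) :
    pRatio x q (d * l + k) = pRatio x q d ^ l * pRatio x q k := by
  rw [pRatio, pRatio, pRatio, qShifted_mul_add _ hq, qShifted_mul_add _ (by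
    rw [← pow_mul, mul_comm, pow_mul, hq, one_pow]), div_pow, div_mul_div_comm]

theorem cTermParam_eq_zero_of_pow_eq_one (a : F) {q : F} {m k : ℕ}
    (hq : q ^ (2 * m + 1) = 1) (hk : m < k) : cTermParam a q k = 0 := by
  rw [cTermParam_eq, cRatio_eq_zero hk, mul_zero]
  right; right
  rw [← hq]; ring

theorem cTermParam_inv (a q : F) (k : ℕ) : cTermParam a⁻¹ q k = cTermParam a q k := by
  rw [cTermParam_eq_pRatio, cTermParam_eq_pRatio, inv_inv]; ring

end PRatio

/-! ### Values of the summands and truncated squares at a root of unity -/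

section EvalRing
variable {R K L : Type*} [CommRing R] [Field K] [Algebra R K] [CommRing L] {φ : R →+* L}

theorem cTermParam_mem_of_pRatio {a q : K} {ζ z : L} (hq : (q, ζ) ∈ evalSubring K φ) {k : ℕ}
    (h : (pRatio a q k * pRatio a⁻¹ q k * pRatio 1 q k, z) ∈ evalSubring K φ) :
    (cTermParam a q k, (-1) ^ k * qInteger ζ (3 * k + 1) * z) ∈ evalSubring K φ := by
  rw [cTermParam_eq_pRatio]
  exact mul_mem_evalSubring (mul_mem_evalSubring (pow_mem_evalSubring neg_one_mem_evalSubring k)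
    (qInteger_mem_evalSubring hq (3 * k + 1))) h

end EvalRing

section EvalField
variable {R K L : Type*} [CommRing R] [Field K] [Algebra R K] [FaithfulSMul R K] [Field L]
  {φ : R →+* L}

theorem div_mem_evalSubring {x y : K} {z w : L} (h : (x, z) ∈ evalSubring K φ)
    (h' : (y, w) ∈ evalSubring K φ) (hw : w ≠ 0) : (x / y, z / w) ∈ evalSubring K φ := by
  have := (evalSubring K φ).mul_mem h (inv_mem_evalSubring h' hw.isUnit)
  rwa [Ring.inverse_eq_inv', Prod.mk_mul_mk, ← div_eq_mul_inv, ← div_eq_mul_inv] at this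

theorem inv_mem_evalSubring_field {y : K} {w : L}
    (h' : (y, w) ∈ evalSubring K φ) (hw : w ≠ 0) : (y⁻¹, w⁻¹) ∈ evalSubring K φ := by
  have := inv_mem_evalSubring h' hw.isUnit
  rwa [Ring.inverse_eq_inv'] at this

theorem pRatio_mem_evalSubring {x q : K} {ξ ζ : L} (hx : (x, ξ) ∈ evalSubring K φ)
    (hq : (q, ζ) ∈ evalSubring K φ) {k : ℕ} (h : ∀ i < k, ξ * ζ ^ (i + 1) ≠ 1) :
    (pRatio x q k, pRatio ξ ζ k) ∈ evalSubring K φ := by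
  have hxq := (evalSubring K φ).mul_mem hx hq
  refine div_mem_evalSubring (qShifted_mem_evalSubring hxq (pow_mem_evalSubring hq 2) k)
    (qShifted_mem_evalSubring hxq hq k) (qShifted_ne_zero fun i hi => ?_)
  rw [mul_assoc, ← pow_succ']
  exact h i hi

theorem cTermParam_mem_evalSubring {a q : K} {α ζ : L} (ha : (a, α) ∈ evalSubring K φ)
    (hα : α ≠ 0) (hq : (q, ζ) ∈ evalSubring K φ) {k : ℕ}
    (h : ∀ i < k, α * ζ ^ (i + 1) ≠ 1 ∧ α ≠ ζ ^ (i + 1) ∧ ζ ^ (i + 1) ≠ 1) :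
    (cTermParam a q k, cTermParam α ζ k) ∈ evalSubring K φ := by
  rw [cTermParam_eq_pRatio α]
  refine cTermParam_mem_of_pRatio hq (mul_mem_evalSubring (mul_mem_evalSubring
    (pRatio_mem_evalSubring ha hq fun i hi => (h i hi).1)
    (pRatio_mem_evalSubring (inv_mem_evalSubring_field ha hα) hq fun i hi h' =>
      (h i hi).2.1 ?_))
    (pRatio_mem_evalSubring (evalSubring K φ).one_mem hq fun i hi => by
      rw [one_mul]; exact (h i hi).2.2))
  field_simp at h'
  exact h'.symm

/-- Numerator and denominator both vanish at ζ beyond the first block. With d = 2m+1, block l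
contributes one vanishing factor to each, 1 - q^(d(2l+1)) above and 1 - q^(d(l+1)) below. Dividing
both by 1 - q^d leaves the value (2l+1)/(l+1), which exists in characteristic zero. -/
theorem exists_pRatio_one_mem_evalSubring [CharZero L] {q : K} {ζ : L}
    (hq : (q, ζ) ∈ evalSubring K φ) (hq1 : ∀ i, q ^ (i + 1) ≠ 1) {m : ℕ}
    (hζ : IsPrimitiveRoot ζ (2 * m + 1)) :
    ∃ γ : ℕ → L, ∀ l k, k < 2 * m + 1 →
      (pRatio 1 q ((2 * m + 1) * l + k), γ l * pRatio 1 ζ k) ∈ evalSubring K φ := by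
  have hper : ∀ l k : ℕ, ζ ^ ((2 * m + 1) * l + k) = ζ ^ k := fun l k => by
    rw [pow_add, pow_mul, hζ.pow_eq_one, one_pow, one_mul]
  have hterm : ∀ i, (1 - q ^ i, 1 - ζ ^ i) ∈ evalSubring K φ := fun i =>
    one_sub_mem_evalSubring (pow_mem_evalSubring hq i)
  have hblock : ∀ l k, pRatio 1 q ((2 * m + 1) * l + k) = pRatio 1 q ((2 * m + 1) * l) *
      ∏ i ∈ Finset.range k, (1 - q ^ (2 * ((2 * m + 1) * l + i) + 1)) /
        (1 - q ^ ((2 * m + 1) * l + i + 1)) := fun l k => by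
    rw [pRatio_one_eq_prod, pRatio_one_eq_prod, Finset.prod_range_add]
  have hne : ∀ l i, i < 2 * m → 1 - ζ ^ ((2 * m + 1) * l + i + 1) ≠ 0 := fun l i hi => by
    rw [add_assoc, hper, sub_ne_zero]
    exact (hζ.pow_ne_one_of_pos_of_lt (by omega) (by omega)).symm
  have hstep : ∀ l, ∃ z, (∏ i ∈ Finset.range (2 * m + 1),
      (1 - q ^ (2 * ((2 * m + 1) * l + i) + 1)) / (1 - q ^ ((2 * m + 1) * l + i + 1)), z) ∈
        evalSubring K φ := by
    intro l
    have hd : 1 - q ^ (2 * m + 1) ≠ 0 := sub_ne_zero.2 (hq1 _).symm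
    have hmain : ∃ z, ((1 - q ^ (2 * ((2 * m + 1) * l + m) + 1)) /
        (1 - q ^ ((2 * m + 1) * l + 2 * m + 1)), z) ∈ evalSubring K φ := by
      rw [show q ^ (2 * ((2 * m + 1) * l + m) + 1) = (q ^ (2 * m + 1)) ^ (2 * l + 1) by
          rw [← pow_mul]; ring_nf,
        show q ^ ((2 * m + 1) * l + 2 * m + 1) = (q ^ (2 * m + 1)) ^ (l + 1) by
          rw [← pow_mul]; ring_nf, ← qInteger_mul_one_sub _ (2 * l + 1),
        ← qInteger_mul_one_sub _ (l + 1), mul_div_mul_right _ _ hd]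
      refine ⟨_, div_mem_evalSubring (qInteger_mem_evalSubring (pow_mem_evalSubring hq _) _)
        (qInteger_mem_evalSubring (pow_mem_evalSubring hq _) _) ?_⟩
      rw [hζ.pow_eq_one]
      simp only [qInteger, one_pow, Finset.sum_const, Finset.card_range, nsmul_eq_mul, mul_one]
      exact_mod_cast Nat.succ_ne_zero l
    obtain ⟨z, hz⟩ := hmain
    rw [Finset.prod_div_distrib, ← Finset.mul_prod_erase (Finset.range (2 * m + 1)) _
      (Finset.mem_range.2 (by omega : m < 2 * m + 1)), Finset.prod_range_succ _ (2 * m),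
      mul_comm (∏ i ∈ Finset.range (2 * m), _), ← div_mul_div_comm]
    exact ⟨_, (evalSubring K φ).mul_mem hz (div_mem_evalSubring
      (prod_mem_evalSubring fun i _ => hterm _) (prod_mem_evalSubring fun i _ => hterm _)
      (Finset.prod_ne_zero_iff.2 fun i hi => hne l i (Finset.mem_range.1 hi)))⟩
  have hγ : ∀ l, ∃ z, (pRatio 1 q ((2 * m + 1) * l), z) ∈ evalSubring K φ := by
    intro l
    induction l with
    | zero => exact ⟨1, by
      rw [mul_zero, pRatio, qShifted_zero, qShifted_zero, div_one]
      exact (evalSubring K φ).one_mem⟩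
    | succ l ih =>
      obtain ⟨z, hz⟩ := ih
      obtain ⟨w, hw⟩ := hstep l
      rw [Nat.mul_succ, hblock]
      exact ⟨z * w, (evalSubring K φ).mul_mem hz hw⟩
  choose γ hγ using hγ
  refine ⟨γ, fun l k hk => ?_⟩
  rw [hblock]
  refine mul_mem_evalSubring (hγ l) ?_
  rw [pRatio_one_eq_prod]
  refine prod_mem_evalSubring fun i hi => ?_
  rw [Finset.mem_range] at hi
  have := div_mem_evalSubring (hterm (2 * ((2 * m + 1) * l + i) + 1))
    (hterm ((2 * m + 1) * l + i + 1)) (hne l i (by omega))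
  rwa [show 2 * ((2 * m + 1) * l + i) + 1 = (2 * m + 1) * (2 * l) + (2 * i + 1) by ring,
    add_assoc _ i 1, hper, hper,
    show (2 * m + 1) * (2 * l) + (2 * i + 1) = 2 * ((2 * m + 1) * l + i) + 1 by ring] at this

/-- Vanishing of the truncated square at a primitive root of unity, generic parameter. -/
theorem truncSquare_cTermParam_mem [CharZero L] {a q : K} {α ζ : L}
    (ha : (a, α) ∈ evalSubring K φ) (hq : (q, ζ) ∈ evalSubring K φ)
    (hq1 : ∀ i, q ^ (i + 1) ≠ 1) {m : ℕ} (hm : 0 < m)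
    (hζ : IsPrimitiveRoot ζ (2 * m + 1)) (hα : α ≠ 0) (hα1 : α ^ (2 * m + 1) ≠ 1)
    (hα2 : α ^ (2 * m + 1) ≠ -1) (e : ℕ) :
    (truncSquare (cTermParam a q) ((2 * m + 1) * e), 0) ∈ evalSubring K φ := by
  obtain ⟨γ, hγ⟩ := exists_pRatio_one_mem_evalSubring hq hq1 hζ
  have hzp : ∀ i : ℕ, (ζ ^ i) ^ (2 * m + 1) = 1 := fun i => by
    rw [← pow_mul, mul_comm, pow_mul, hζ.pow_eq_one, one_pow]
  have hα1' : ∀ i, α * ζ ^ i ≠ 1 := fun i h => hα1 (by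
    have := congrArg (· ^ (2 * m + 1)) h
    simpa [mul_pow, hzp] using this)
  have hα2' : ∀ i, α⁻¹ * ζ ^ i ≠ 1 := fun i h => hα1 (by
    field_simp at h
    rw [← h, hzp])
  set z : ℕ → L := fun k => (-1) ^ k * qInteger ζ (3 * k + 1) * (pRatio α ζ k * pRatio α⁻¹ ζ k *
    (γ (k / (2 * m + 1)) * pRatio 1 ζ (k % (2 * m + 1)))) with hz
  have hmem : ∀ k, (cTermParam a q k, z k) ∈ evalSubring K φ := by
    intro k
    refine cTermParam_mem_of_pRatio hq (mul_mem_evalSubring (mul_mem_evalSubring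
      (pRatio_mem_evalSubring ha hq fun i _ => hα1' _)
      (pRatio_mem_evalSubring (inv_mem_evalSubring_field ha hα) hq fun i _ => hα2' _)) ?_)
    have := hγ (k / (2 * m + 1)) (k % (2 * m + 1)) (Nat.mod_lt _ (by omega))
    rwa [Nat.div_add_mod] at this
  have h0 := truncSquare_mem_evalSubring (n := (2 * m + 1) * e) fun k _ => hmem k
  have hone : ζ ≠ 1 := by
    have := hζ.pow_ne_one_of_pos_of_lt one_ne_zero (by omega)
    simpa using this
  have hint : ∀ l k, qInteger ζ (3 * ((2 * m + 1) * l + k) + 1) = qInteger ζ (3 * k + 1) := by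
    intro l k
    apply mul_right_cancel₀ (sub_ne_zero.2 hone.symm)
    rw [qInteger_mul_one_sub, qInteger_mul_one_sub,
      show 3 * ((2 * m + 1) * l + k) + 1 = (2 * m + 1) * (3 * l) + (3 * k + 1) by ring, pow_add,
      pow_mul, hζ.pow_eq_one, one_pow, one_mul]
  rwa [truncSquare_eq_zero_of_blocks (w := cTermParam α ζ)
    (C := fun l => (-1) ^ ((2 * m + 1) * l) * pRatio α ζ (2 * m + 1) ^ l *
      pRatio α⁻¹ ζ (2 * m + 1) ^ l * γ l) ?_ (fun k h _ =>
      cTermParam_eq_zero_of_pow_eq_one α hζ.pow_eq_one h)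
      (sum_cTermParam_primitiveRoot hζ hm α hα hα1 hα2)] at h0
  intro l k hk
  simp only [hz, hint, pRatio_mul_add _ hζ.pow_eq_one]
  rw [Nat.mul_add_mod, Nat.mod_eq_of_lt hk, Nat.mul_add_div (by omega), Nat.div_eq_of_lt hk,
    add_zero, cTermParam_eq_pRatio, pow_add]
  ring

/-- Vanishing of the truncated square at a primitive root of unity, trivial parameter. -/
theorem truncSquare_cTerm_mem [CharZero L] {q : K} {ζ : L} (hq : (q, ζ) ∈ evalSubring K φ)
    (hq1 : ∀ i, q ^ (i + 1) ≠ 1) {m : ℕ} (hm : 0 < m)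
    (hζ : IsPrimitiveRoot ζ (2 * m + 1)) (e : ℕ) :
    (truncSquare (cTerm q) ((2 * m + 1) * e), 0) ∈ evalSubring K φ := by
  obtain ⟨γ, hγ⟩ := exists_pRatio_one_mem_evalSubring hq hq1 hζ
  have hq0 : q ≠ 0 := by
    rintro rfl
    have := evalSubring_unique hq (evalSubring K φ).zero_mem
    exact hζ.ne_zero (by omega) this
  have hone : ζ ≠ 1 := by
    have := hζ.pow_ne_one_of_pos_of_lt one_ne_zero (by omega)
    simpa using this
  -- The parameter 1 is excluded from `sum_cTermParam_primitiveRoot`. The terminating sum at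
  -- q^(-(2m+1)) replaces it: at ζ that parameter becomes 1 and the factor [2m+1] becomes 0.
  have hsum : ∑ k ∈ Finset.range (m + 1), cTermParam 1 ζ k = 0 := by
    have h1 : ((q ^ (2 * m + 1))⁻¹, (1 : L)) ∈ evalSubring K φ := by
      have := inv_mem_evalSubring_field (pow_mem_evalSubring hq (2 * m + 1))
        (by rw [hζ.pow_eq_one]; exact one_ne_zero)
      rwa [hζ.pow_eq_one, inv_one] at this
    have h2 := sum_mem_evalSubring (s := Finset.range (m + 1)) fun k hk =>
      cTermParam_mem_evalSubring h1 one_ne_zero hq (k := k) fun i hi => by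
        have := hζ.pow_ne_one_of_pos_of_lt (l := i + 1) (by omega)
          (by rw [Finset.mem_range] at hk; omega)
        exact ⟨by rwa [one_mul], this.symm, this⟩
    rw [sum_cTermParam_inv_pow q hq0 hq1] at h2
    have h3 := mul_mem_evalSubring (pow_mem_evalSubring neg_one_mem_evalSubring m)
      (pow_mem_evalSubring hq (m ^ 2))
    have h4 := mul_mem_evalSubring h3 (qInteger_mem_evalSubring hq (2 * m + 1))
    have h5 : qInteger ζ (2 * m + 1) = 0 := by
      apply mul_right_cancel₀ (sub_ne_zero.2 hone.symm)
      rw [qInteger_mul_one_sub, hζ.pow_eq_one]; ring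
    rw [h5, mul_zero] at h4
    exact evalSubring_unique h2 h4
  set z : ℕ → L := fun k => (-1) ^ k * qInteger ζ (3 * k + 1) *
    ((γ (k / (2 * m + 1)) * pRatio 1 ζ (k % (2 * m + 1))) *
     (γ (k / (2 * m + 1)) * pRatio 1 ζ (k % (2 * m + 1))) *
    (γ (k / (2 * m + 1)) * pRatio 1 ζ (k % (2 * m + 1)))) with hz
  have hmem : ∀ k, (cTerm q k, z k) ∈ evalSubring K φ := by
    intro k
    have := hγ (k / (2 * m + 1)) (k % (2 * m + 1)) (Nat.mod_lt _ (by omega))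
    rw [Nat.div_add_mod] at this
    rw [cTerm_eq_cTermParam]
    exact cTermParam_mem_of_pRatio hq (mul_mem_evalSubring
      (mul_mem_evalSubring this (by rwa [inv_one])) this)
  have h0 := truncSquare_mem_evalSubring (n := (2 * m + 1) * e) fun k _ => hmem k
  have hint : ∀ l k, qInteger ζ (3 * ((2 * m + 1) * l + k) + 1) = qInteger ζ (3 * k + 1) := by
    intro l k
    apply mul_right_cancel₀ (sub_ne_zero.2 hone.symm)
    rw [qInteger_mul_one_sub, qInteger_mul_one_sub,
      show 3 * ((2 * m + 1) * l + k) + 1 = (2 * m + 1) * (3 * l) + (3 * k + 1) by ring, pow_add,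
      pow_mul, hζ.pow_eq_one, one_pow, one_mul]
  rwa [truncSquare_eq_zero_of_blocks (w := cTermParam 1 ζ)
    (C := fun l => (-1) ^ ((2 * m + 1) * l) * γ l ^ 3) ?_ (fun k h _ =>
      cTermParam_eq_zero_of_pow_eq_one 1 hζ.pow_eq_one h) hsum] at h0
  intro l k hk
  simp only [hz, hint]
  rw [Nat.mul_add_mod, Nat.mod_eq_of_lt hk, Nat.mul_add_div (by omega), Nat.div_eq_of_lt hk,
    add_zero, cTermParam_eq_pRatio, pow_add, inv_one]
  ring

end EvalField


/-! ### From values to divisibility of numerators -/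

section Numerators
variable {R K : Type*} [CommRing R] [IsDomain R] [UniqueFactorizationMonoid R] [Field K]
  [Algebra R K] [IsFractionRing R K]

theorem map_num_eq_zero {L : Type*} [CommRing L] {φ : R →+* L} {x : K}
    (h : (x, 0) ∈ evalSubring K φ) : φ (IsFractionRing.num R x) = 0 := by
  obtain ⟨u, v, h1, h2, h3⟩ := h
  dsimp only at h2 h3
  rw [zero_mul] at h3
  have hden : algebraMap R K (IsFractionRing.den R x) ≠ 0 :=
    IsFractionRing.to_map_ne_zero_of_mem_nonZeroDivisors (IsFractionRing.den R x).2
  have hx := IsFractionRing.mk'_num_den' R x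
  rw [div_eq_iff hden] at hx
  have : IsFractionRing.num R x * v = u * (IsFractionRing.den R x : R) := by
    apply IsFractionRing.injective R K
    rw [map_mul, map_mul, hx, ← h2]
    ring
  have := congrArg φ this
  rw [map_mul, map_mul, ← h3, zero_mul] at this
  exact (h1.mul_left_eq_zero).1 this

/-- A common divisor of m and the reduced denominator divides the numerator too, hence is a unit. -/
theorem fracCongr_of_dvd_num {m : R} {x y : K} (h : m ∣ IsFractionRing.num R (x - y)) :
    FracCongr m x y := by
  obtain ⟨u, hu⟩ := h
  refine ⟨u, IsFractionRing.den R (x - y), nonZeroDivisors.coe_ne_zero _, ?_, ?_⟩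
  · intro d h1 h2
    exact IsFractionRing.num_den_reduced R (x - y) (h2.trans ⟨u, hu⟩) h1
  · rw [← hu, IsFractionRing.mk'_num_den']

end Numerators

/-! ### Residue fields and divisibility criteria -/

section Quotients
open Polynomial

theorem map_cyclotomic_eq_eval {L : Type*} [CommRing L] (ψ : ℚ[X] →+* L) (d : ℕ) :
    ψ (cyclotomic d ℚ) = (cyclotomic d L).eval (ψ X) := by
  rw [← map_cyclotomic_int d ℚ, ← map_cyclotomic_int d L, eval_map,
    RingHom.ext_int (Int.castRingHom L) ((ψ.comp C).comp (Int.castRingHom ℚ)),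
    ← eval₂_map, ← hom_eval₂ _ C ψ X, eval₂_C_X]

theorem isPrimitiveRoot_of_map_cyclotomic {L : Type*} [Field L] [CharZero L] (ψ : ℚ[X] →+* L)
    {d : ℕ} (hd : 0 < d) (h : ψ (cyclotomic d ℚ) = 0) : IsPrimitiveRoot (ψ X) d := by
  have : NeZero (d : L) := ⟨by exact_mod_cast hd.ne'⟩
  rw [← isRoot_cyclotomic_iff, IsRoot.def, ← map_cyclotomic_eq_eval, h]

theorem map_qInteger {A B : Type*} [CommRing A] [CommRing B] (f : A →+* B) (q : A) (n : ℕ) :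
    f (qInteger q n) = qInteger (f q) n := by
  simp [qInteger]

theorem qInteger_eq_zero_of_pow_eq_one {L : Type*} [Field L] {z : L} {n : ℕ} (h : z ≠ 1)
    (hz : z ^ n = 1) : qInteger z n = 0 := by
  apply mul_right_cancel₀ (sub_ne_zero.2 h.symm)
  rw [qInteger_mul_one_sub, hz, sub_self, zero_mul]

/-- The canonical map from a ring to the fraction field of its quotient by a prime element. -/
noncomputable def residueMap {R : Type*} [CommRing R] (p : R) :
    R →+* FractionRing (R ⧸ Ideal.span {p}) :=
  (algebraMap _ _).comp (Ideal.Quotient.mk (Ideal.span {p}))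

theorem residueMap_eq_zero_iff {R : Type*} [CommRing R] {p : R} (r : R) :
    residueMap p r = 0 ↔ p ∣ r := by
  rw [residueMap, RingHom.comp_apply, FaithfulSMul.algebraMap_eq_zero_iff,
    Ideal.Quotient.eq_zero_iff_mem, Ideal.mem_span_singleton]

theorem X_pow_ne_one {A : Type*} [CommRing A] [Nontrivial A] (i : ℕ) : (X : A[X]) ^ (i + 1) ≠ 1 := by
  intro h
  have := congrArg natDegree h
  rw [natDegree_X_pow, natDegree_one] at this
  omega

/-- A divisor of a nonzero constant is constant, so it divides every coefficient of f, including the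
unit. -/
theorem isRelPrime_C_of_isUnit_coeff {A : Type*} [CommRing A] [IsDomain A] {g : A} (hg : g ≠ 0)
    {f : A[X]} {i : ℕ} (hf : IsUnit (f.coeff i)) : IsRelPrime (C g) f := by
  intro d h1 h2
  have hd : d.natDegree = 0 := by
    have := natDegree_le_of_dvd h1 (C_ne_zero.2 hg)
    simpa using this
  rw [eq_C_of_natDegree_eq_zero hd] at h2 ⊢
  exact isUnit_C.2 (isUnit_of_dvd_unit ((C_dvd_iff_dvd_coeff _ _).1 h2 i) hf)

/-- The divisor need not be monic. With N = deg f, the hypothesis gives r^N f = ∑ f_i r^(N-i)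
((rX)^i - 1), which 1 - rX divides; and 1 - rX is coprime to r^N. -/
theorem one_sub_C_mul_X_dvd {A K : Type*} [CommRing A] [Field K] [Algebra A K]
    [FaithfulSMul A K] {r : A} (hr : algebraMap A K r ≠ 0) {f : A[X]}
    (h : eval₂ (algebraMap A K) (algebraMap A K r)⁻¹ f = 0) : 1 - C r * X ∣ f := by
  set N := f.natDegree
  have hs : ∑ i ∈ Finset.range (N + 1), f.coeff i * r ^ (N - i) = 0 := by
    apply FaithfulSMul.algebraMap_injective A K
    rw [map_sum, map_zero]
    rw [eval₂_eq_sum_range] at h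
    have := congrArg (fun y => algebraMap A K r ^ N * y) h
    simp only [mul_zero, Finset.mul_sum] at this
    rw [← this]
    refine Finset.sum_congr rfl fun i hi => ?_
    have hi : i ≤ N := by rw [Finset.mem_range] at hi; omega
    obtain ⟨t, ht⟩ := Nat.exists_eq_add_of_le hi
    rw [ht, Nat.add_sub_cancel_left, map_mul, map_pow, pow_add, inv_pow]
    field_simp
  have hdvd : 1 - C r * X ∣ C (r ^ N) * f := by
    have e : C (r ^ N) * f = ∑ i ∈ Finset.range (N + 1),
        C (f.coeff i * r ^ (N - i)) * ((C r * X) ^ i - 1) := by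
      simp only [mul_sub, Finset.sum_sub_distrib, mul_one]
      rw [← map_sum, hs, map_zero, sub_zero]
      conv_lhs => rw [f.as_sum_range_C_mul_X_pow, Finset.mul_sum]
      refine Finset.sum_congr rfl fun i hi => ?_
      have hi : i ≤ N := by rw [Finset.mem_range] at hi; omega
      obtain ⟨t, ht⟩ := Nat.exists_eq_add_of_le hi
      rw [ht, Nat.add_sub_cancel_left]
      simp only [map_mul, map_pow]
      ring
    rw [e]
    refine Finset.dvd_sum fun i _ => Dvd.dvd.mul_left ?_ _
    have := sub_dvd_pow_sub_pow (C r * X) 1 i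
    rw [one_pow] at this
    exact (dvd_sub_comm).1 (by
      rw [← neg_sub, neg_dvd, dvd_sub_comm]; exact this)
  have hcop : IsCoprime (1 - C r * X) (C (r ^ N)) := by
    rw [map_pow]
    exact IsCoprime.pow_right ⟨1, X, by ring⟩
  exact hcop.dvd_of_dvd_mul_left hdvd

end Quotients


/-! ### The congruence with parameter -/

section ParametricCongruence
open Polynomial

theorem pow_ne_pow_of_pow_ne_one {F : Type*} [Field F] {q : F} (hq : q ≠ 0)
    (hq1 : ∀ i, q ^ (i + 1) ≠ 1) {i j : ℕ} (h : i < j) : q ^ i ≠ q ^ j := by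
  obtain ⟨t, rfl⟩ := Nat.exists_eq_add_of_lt h
  intro h
  apply hq1 t
  apply mul_left_cancel₀ (pow_ne_zero i hq)
  rw [mul_one, ← pow_add, h, add_assoc]

/-- Evaluation of the truncated square at `a = q ^ n`. -/
theorem truncSquare_cTermParam_pow {F : Type*} [Field F] {q : F} (hq : q ≠ 0)
    (hq1 : ∀ i, q ^ (i + 1) ≠ 1) (m : ℕ) :
    truncSquare (cTermParam (q ^ (2 * m + 1)) q) (2 * m + 1) =
      q ^ (2 * m ^ 2) * qInteger q (2 * m + 1) ^ 2 := by
  have hA : q ^ (2 * m + 1) ≠ 0 := pow_ne_zero _ hq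
  rw [show cTermParam (q ^ (2 * m + 1)) q = cTermParam (q ^ (2 * m + 1))⁻¹ q from
    funext fun k => (cTermParam_inv _ _ _).symm, truncSquare_of_eq_zero,
    sum_cTermParam_inv_pow q hq hq1]
  · rw [mul_pow, mul_pow, ← pow_mul, mul_comm m 2, pow_mul, neg_one_sq, one_pow, one_mul,
      ← pow_mul, mul_comm (m ^ 2)]
  · intro k hk _
    rw [cTermParam_eq, cRatio_eq_zero hk, mul_zero]
    left
    field_simp
    ring

variable {R K L : Type*} [CommRing R] [Field K] [Algebra R K] [FaithfulSMul R K] [Field L]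
  {φ : R →+* L}

theorem truncSquare_cTermParam_sub_mem {a q : K} {ζ : L} {m : ℕ}
    (hq : (q, ζ) ∈ evalSubring K φ) (hζ : ζ ≠ 0) (hζ1 : ∀ i, ζ ^ (i + 1) ≠ 1)
    (ha : (a, ζ ^ (2 * m + 1)) ∈ evalSubring K φ ∨ (a, (ζ ^ (2 * m + 1))⁻¹) ∈ evalSubring K φ) :
    (truncSquare (cTermParam a q) (2 * m + 1) - q ^ (2 * m ^ 2) * qInteger q (2 * m + 1) ^ 2,
      0) ∈ evalSubring K φ := by
  have hA : ζ ^ (2 * m + 1) ≠ 0 := pow_ne_zero _ hζ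
  have hc : ∀ k < 2 * m + 1,
      (cTermParam a q k, cTermParam (ζ ^ (2 * m + 1)) ζ k) ∈ evalSubring K φ := by
    intro k hk
    have h1 : ∀ i, ζ ^ (2 * m + 1) * ζ ^ (i + 1) ≠ 1 := fun i => by
      rw [← pow_add, ← add_assoc]; exact hζ1 _
    have h2 : ∀ i < k, ζ ^ (2 * m + 1) ≠ ζ ^ (i + 1) := fun i hi =>
      (pow_ne_pow_of_pow_ne_one hζ hζ1 (by omega)).symm
    rcases ha with ha | ha
    · exact cTermParam_mem_evalSubring ha hA hq fun i hi => ⟨h1 i, h2 i hi, hζ1 i⟩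
    · rw [← cTermParam_inv (ζ ^ (2 * m + 1))]
      refine cTermParam_mem_evalSubring ha (inv_ne_zero hA) hq fun i hi =>
        ⟨fun h => h2 i hi ?_, fun h => h1 i ?_, hζ1 i⟩
      · field_simp at h; exact h.symm
      · rw [← h, mul_inv_cancel₀ hA]
  have h1 := truncSquare_mem_evalSubring hc
  rw [truncSquare_cTermParam_pow hζ hζ1] at h1
  have h2 := mul_mem_evalSubring (pow_mem_evalSubring hq (2 * m ^ 2))
    (pow_mem_evalSubring (qInteger_mem_evalSubring hq (2 * m + 1)) 2)
  have := (evalSubring K φ).sub_mem h1 h2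
  rwa [Prod.mk_sub_mk, sub_self] at this

theorem not_C_dvd_of_monic {A : Type*} [CommRing A] {p : A} (hp : ¬ IsUnit p) {f : A[X]}
    (hf : f.Monic) : ¬ C p ∣ f := by
  intro h
  have := (C_dvd_iff_dvd_coeff _ _).1 h f.natDegree
  rw [hf.coeff_natDegree] at this
  exact hp (isUnit_of_dvd_one this)

theorem algebraMap_injective_ratQA : Function.Injective (algebraMap PolyQA RatQA) :=
  IsFractionRing.injective PolyQA RatQA

instance faithfulSMul_ratQA : FaithfulSMul PolyQA RatQA :=
  (faithfulSMul_iff_algebraMap_injective _ _).2 algebraMap_injective_ratQA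

theorem algebraMap_varQ_pow_ne_one (i : ℕ) : algebraMap PolyQA RatQA varQ ^ (i + 1) ≠ 1 := by
  rw [← map_pow, ← map_one (algebraMap PolyQA RatQA)]
  refine algebraMap_injective_ratQA.ne ?_
  rw [varQ, ← map_pow, ← map_one C]
  exact C_injective.ne (X_pow_ne_one i)

/-- The difference of the two sides of the parametric congruence. -/
noncomputable def paramDiff (m : ℕ) : RatQA :=
  truncSquare (cTermParam (algebraMap PolyQA RatQA varA) (algebraMap PolyQA RatQA varQ))
      (2 * m + 1) -
    algebraMap PolyQA RatQA varQ ^ (2 * m ^ 2) *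
      qInteger (algebraMap PolyQA RatQA varQ) (2 * m + 1) ^ 2

theorem ratFunc_X_pow_ne_one (i : ℕ) : (RatFunc.X : RatFunc ℚ) ^ (i + 1) ≠ 1 := by
  rw [← RatFunc.algebraMap_X, ← map_pow, ← map_one (algebraMap ℚ[X] (RatFunc ℚ))]
  exact (RatFunc.algebraMap_injective ℚ).ne (X_pow_ne_one i)

theorem varA_sub_dvd_num (m : ℕ) :
    varA - varQ ^ (2 * m + 1) ∣ IsFractionRing.num PolyQA (paramDiff m) := by
  let φ : PolyQA →+* RatFunc ℚ :=
    (algebraMap ℚ[X] (RatFunc ℚ)).comp (evalRingHom (X ^ (2 * m + 1)))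
  have hq : φ varQ = RatFunc.X := by simp [φ, varQ]
  have ha : φ varA = RatFunc.X ^ (2 * m + 1) := by simp [φ, varA]
  have h := map_num_eq_zero (truncSquare_cTermParam_sub_mem (m := m) (φ := φ)
    (hq ▸ algebraMap_mem_evalSubring (K := RatQA) varQ) RatFunc.X_ne_zero ratFunc_X_pow_ne_one
    (Or.inl (ha ▸ algebraMap_mem_evalSubring (K := RatQA) varA)))
  rw [varA, varQ, ← map_pow, dvd_iff_isRoot]
  exact (FaithfulSMul.algebraMap_eq_zero_iff ℚ[X] (RatFunc ℚ)).1 h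

theorem one_sub_varA_mul_dvd_num (m : ℕ) :
    1 - varA * varQ ^ (2 * m + 1) ∣ IsFractionRing.num PolyQA (paramDiff m) := by
  let φ : PolyQA →+* RatFunc ℚ := eval₂RingHom (algebraMap ℚ[X] (RatFunc ℚ))
    (algebraMap ℚ[X] (RatFunc ℚ) (X ^ (2 * m + 1)))⁻¹
  have hq : φ varQ = RatFunc.X := by simp [φ, varQ]
  have ha : φ varA = (RatFunc.X ^ (2 * m + 1))⁻¹ := by simp [φ, varA]
  have h := map_num_eq_zero (truncSquare_cTermParam_sub_mem (m := m) (φ := φ)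
    (hq ▸ algebraMap_mem_evalSubring (K := RatQA) varQ) RatFunc.X_ne_zero ratFunc_X_pow_ne_one
    (Or.inr (ha ▸ algebraMap_mem_evalSubring (K := RatQA) varA)))
  rw [varA, varQ, ← map_pow, mul_comm]
  exact one_sub_C_mul_X_dvd (by simp [RatFunc.X_ne_zero]) h

/-- In the fraction field of ℚ[q,a]/(Φ_d(q)), q is a primitive d-th root of unity, while no monic
polynomial in a vanishes, so a is nonzero and a^d ≠ ±1. Both the truncated square and [2m+1] are
then 0. -/
theorem C_cyclotomic_dvd_num {m d : ℕ} (hd : d ∣ 2 * m + 1) (hd1 : d ≠ 1) :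
    C (cyclotomic d ℚ) ∣ IsFractionRing.num PolyQA (paramDiff m) := by
  obtain ⟨e, he⟩ := hd
  have hodd : Odd d := (Nat.odd_mul.1 (he ▸ ⟨m, rfl⟩ : Odd (d * e))).1
  obtain ⟨s, rfl⟩ := hodd
  have hirr := cyclotomic.irreducible_rat (by omega : 0 < 2 * s + 1)
  have hprime : Prime (C (cyclotomic (2 * s + 1) ℚ)) := prime_C_iff.2 hirr.prime
  have : (Ideal.span {C (cyclotomic (2 * s + 1) ℚ)}).IsPrime :=
    (Ideal.span_singleton_prime hprime.ne_zero).2 hprime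
  set φ := residueMap (C (cyclotomic (2 * s + 1) ℚ)) with hφ
  have hchar : CharZero (FractionRing (PolyQA ⧸ Ideal.span {C (cyclotomic (2 * s + 1) ℚ)})) :=
    charZero_of_injective_ringHom ((φ.comp C).comp C).injective
  have hζ : IsPrimitiveRoot (φ varQ) (2 * s + 1) :=
    isPrimitiveRoot_of_map_cyclotomic (φ.comp C) (by omega)
      ((residueMap_eq_zero_iff _).2 dvd_rfl)
  have hmon : ∀ f : PolyQA, f.Monic → φ f ≠ 0 := fun f hf h =>
    not_C_dvd_of_monic hirr.not_isUnit hf ((residueMap_eq_zero_iff _).1 h)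
  have hα : φ varA ≠ 0 := hmon _ monic_X
  have hα1 : φ varA ^ (2 * s + 1) ≠ 1 := by
    rw [← sub_ne_zero, ← map_pow, ← map_one φ, ← map_sub]
    exact hmon _ (monic_X_pow_sub_C (1 : ℚ[X]) (by omega))
  have hα2 : φ varA ^ (2 * s + 1) ≠ -1 := by
    rw [← sub_ne_zero, sub_neg_eq_add, ← map_pow, ← map_one φ, ← map_add]
    exact hmon _ (monic_X_pow_add_C (1 : ℚ[X]) (by omega))
  have hq := algebraMap_mem_evalSubring (K := RatQA) (φ := φ) varQ
  have h1 := truncSquare_cTermParam_mem (algebraMap_mem_evalSubring (K := RatQA) varA) hq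
    algebraMap_varQ_pow_ne_one (by omega) hζ hα hα1 hα2 e
  rw [← he] at h1
  have h2 := mul_mem_evalSubring (pow_mem_evalSubring hq (2 * m ^ 2))
    (pow_mem_evalSubring (qInteger_mem_evalSubring hq (2 * m + 1)) 2)
  have h3 : qInteger (φ varQ) (2 * m + 1) = 0 := by
    refine qInteger_eq_zero_of_pow_eq_one ?_ (by rw [he, pow_mul, hζ.pow_eq_one, one_pow])
    have := hζ.pow_ne_one_of_pos_of_lt one_ne_zero (by omega)
    simpa using this
  rw [h3, zero_pow two_ne_zero, mul_zero] at h2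
  have h4 := (evalSubring RatQA φ).sub_mem h1 h2
  rw [Prod.mk_sub_mk, sub_zero] at h4
  exact (residueMap_eq_zero_iff _).1 (map_num_eq_zero h4)

theorem qInteger_X_eq_prod (n : ℕ) (hn : 0 < n) :
    qInteger (X : ℚ[X]) n = ∏ d ∈ n.divisors.erase 1, cyclotomic d ℚ :=
  (prod_cyclotomic_eq_geom_sum hn ℚ).symm

theorem qInteger_X_ne_zero {n : ℕ} (hn : 0 < n) : qInteger (X : ℚ[X]) n ≠ 0 := by
  rw [qInteger_X_eq_prod n hn, Finset.prod_ne_zero_iff]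
  exact fun d _ => cyclotomic_ne_zero d ℚ

theorem fracCongr_param (m : ℕ) :
    FracCongr (qInteger varQ (2 * m + 1) *
        ((1 - varA * varQ ^ (2 * m + 1)) * (varA - varQ ^ (2 * m + 1))))
      (truncSquare (cTermParam (algebraMap PolyQA RatQA varA) (algebraMap PolyQA RatQA varQ))
        (2 * m + 1))
      (algebraMap PolyQA RatQA varQ ^ (2 * m ^ 2) *
        qInteger (algebraMap PolyQA RatQA varQ) (2 * m + 1) ^ 2) := by
  apply fracCongr_of_dvd_num
  change _ ∣ IsFractionRing.num PolyQA (paramDiff m)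
  have hC : qInteger varQ (2 * m + 1) = C (qInteger X (2 * m + 1)) := (map_qInteger C _ _).symm
  refine IsRelPrime.mul_dvd ?_ ?_ (IsRelPrime.mul_dvd ?_ (one_sub_varA_mul_dvd_num m)
    (varA_sub_dvd_num m))
  · rw [hC]
    -- As polynomials in a, 1 - aq^n has constant coefficient 1 and a - q^n has linear coefficient
    -- 1.
    refine IsRelPrime.mul_right
      (isRelPrime_C_of_isUnit_coeff (qInteger_X_ne_zero (by omega)) (i := 0) ?_)
      (isRelPrime_C_of_isUnit_coeff (qInteger_X_ne_zero (by omega)) (i := 1) ?_)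
    · rw [varA, coeff_sub, coeff_one_zero, mul_coeff_zero, coeff_X_zero, zero_mul, sub_zero]
      exact isUnit_one
    · rw [varA, varQ, ← map_pow, coeff_sub, coeff_X_one, coeff_C_of_ne_zero one_ne_zero, sub_zero]
      exact isUnit_one
  · rw [hC, qInteger_X_eq_prod _ (by omega), map_prod]
    refine Finset.prod_dvd_of_coprime (fun d _ d' _ hdd => ?_) fun d hd => ?_
    · exact (cyclotomic.isCoprime_rat hdd).map C
    · rw [Finset.mem_erase, Nat.mem_divisors] at hd
      exact C_cyclotomic_dvd_num hd.2.1 hd.1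
  -- The irreducible a - q^n does not divide 1 - aq^n, whose value at a = q^n is 1 - q^(2n) ≠ 0.
  · apply IsRelPrime.symm
    rw [varA, varQ, ← map_pow, (prime_X_sub_C _).irreducible.isRelPrime_iff_not_dvd,
      dvd_iff_isRoot, IsRoot.def]
    simp only [eval_sub, eval_one, eval_mul, eval_X, eval_C, ← pow_add]
    exact sub_ne_zero.2 (X_pow_ne_one _).symm

end ParametricCongruence


/-! ### Congruences modulo powers of 1 - q^n -/

section SquareCongruence
variable {R K L : Type*} [CommRing R] [Field K] [Algebra R K] [FaithfulSMul R K] [CommRing L]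
  [Nontrivial L] {φ : R →+* L}

/-- This is (1 - xy)(1 - y/x) = (1 - y)² - (y/x)(1 - x)². The target L is only a ring, so that 1 - ξ
may be a nonzero nilpotent. -/
theorem one_sub_mul_one_sub_mem_evalSubring {x y : K} {ξ η : L}
    (hx : (x, ξ) ∈ evalSubring K φ) (hξ : IsUnit ξ) (hξ1 : (1 - ξ) ^ 2 = 0)
    (hy : (y, η) ∈ evalSubring K φ) :
    ((1 - x * y) * (1 - x⁻¹ * y), (1 - η) ^ 2) ∈ evalSubring K φ := by
  have hi := inv_mem_evalSubring hx hξ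
  have h := (evalSubring K φ).sub_mem (pow_mem_evalSubring (one_sub_mem_evalSubring hy) 2)
    (mul_mem_evalSubring (mul_mem_evalSubring hy hi)
      (pow_mem_evalSubring (one_sub_mem_evalSubring hx) 2))
  rw [hξ1, mul_zero, Prod.mk_sub_mk, sub_zero] at h
  have hx0 : x ≠ 0 := by
    rintro rfl
    have := evalSubring_unique hx (evalSubring K φ).zero_mem
    rw [this] at hξ
    exact not_isUnit_zero hξ
  convert h using 2
  field_simp
  ring

theorem qShifted_mul_qShifted_mem_evalSubring {x y q : K} {ξ η ζ : L}
    (hx : (x, ξ) ∈ evalSubring K φ) (hξ : IsUnit ξ) (hξ1 : (1 - ξ) ^ 2 = 0)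
    (hy : (y, η) ∈ evalSubring K φ) (hq : (q, ζ) ∈ evalSubring K φ) (k : ℕ) :
    (qShifted (x * y) q k * qShifted (x⁻¹ * y) q k, qShifted η ζ k ^ 2) ∈ evalSubring K φ := by
  rw [qShifted, qShifted, qShifted, ← Finset.prod_mul_distrib, ← Finset.prod_pow]
  refine prod_mem_evalSubring fun i _ => ?_
  have := one_sub_mul_one_sub_mem_evalSubring hx hξ hξ1
    (mul_mem_evalSubring hy (pow_mem_evalSubring hq i))
  rwa [← mul_assoc, ← mul_assoc] at this

theorem isUnit_qShifted {A : Type*} [CommRing A] {x q : A} {k : ℕ} (h : ∀ i < k, IsUnit (1 - x * q ^ i)) :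
    IsUnit (qShifted x q k) := by
  rw [qShifted, IsUnit.prod_iff]
  exact fun i hi => h i (Finset.mem_range.1 hi)

theorem cTerm_mem_evalSubring {q : K} {ζ : L} (hq : (q, ζ) ∈ evalSubring K φ) {k : ℕ}
    (hu : ∀ i < k, IsUnit (1 - ζ ^ (i + 1))) :
    (cTerm q k, (-1) ^ k * qInteger ζ (3 * k + 1) *
      (qShifted ζ (ζ ^ 2) k ^ 3 * Ring.inverse (qShifted ζ ζ k ^ 3))) ∈ evalSubring K φ := by
  rw [cTerm, div_eq_mul_inv]
  refine mul_mem_evalSubring (mul_mem_evalSubring (pow_mem_evalSubring neg_one_mem_evalSubring k)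
    (qInteger_mem_evalSubring hq (3 * k + 1))) (mul_mem_evalSubring
    (pow_mem_evalSubring (qShifted_mem_evalSubring hq (pow_mem_evalSubring hq 2) k) 3)
    (inv_mem_evalSubring (pow_mem_evalSubring (qShifted_mem_evalSubring hq hq k) 3)
      (IsUnit.pow 3 (isUnit_qShifted fun i hi => ?_))))
  rw [← pow_succ']
  exact hu i hi

/-- Moving the parameter `x` with `(1 - x)² = 0` to `1` does not change the value. -/
theorem cTermParam_mem_evalSubring_of_sq_eq_zero {x q : K} {ξ ζ : L}
    (hx : (x, ξ) ∈ evalSubring K φ) (hξ : IsUnit ξ) (hξ1 : (1 - ξ) ^ 2 = 0)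
    (hq : (q, ζ) ∈ evalSubring K φ) {k : ℕ} (hu : ∀ i < k, IsUnit (1 - ζ ^ (i + 1))) :
    (cTermParam x q k, (-1) ^ k * qInteger ζ (3 * k + 1) *
      (qShifted ζ (ζ ^ 2) k ^ 3 * Ring.inverse (qShifted ζ ζ k ^ 3))) ∈ evalSubring K φ := by
  have hu' : IsUnit (qShifted ζ ζ k) := isUnit_qShifted fun i hi => by
    rw [← pow_succ']; exact hu i hi
  rw [cTermParam, div_eq_mul_inv, div_eq_mul_inv q x, mul_comm q x⁻¹]
  refine mul_mem_evalSubring (mul_mem_evalSubring (pow_mem_evalSubring neg_one_mem_evalSubring k)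
    (qInteger_mem_evalSubring hq (3 * k + 1))) ?_
  rw [pow_succ (qShifted ζ (ζ ^ 2) k), pow_succ (qShifted ζ ζ k)]
  exact mul_mem_evalSubring (mul_mem_evalSubring
    (qShifted_mul_qShifted_mem_evalSubring hx hξ hξ1 hq (pow_mem_evalSubring hq 2) k)
    (qShifted_mem_evalSubring hq (pow_mem_evalSubring hq 2) k))
    (inv_mem_evalSubring (mul_mem_evalSubring
      (qShifted_mul_qShifted_mem_evalSubring hx hξ hξ1 hq hq k)
      (qShifted_mem_evalSubring hq hq k)) ((hu'.pow 2).mul hu'))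

/-- Replacing the parameter 1 by q^(2m+1) does not change the values of the terms, and inverting it
changes no term, so the terminating sum at q^(-(2m+1)) applies. -/
theorem sum_cTerm_sub_mem_evalSubring {q : K} {ζ : L} {m : ℕ} (hq : (q, ζ) ∈ evalSubring K φ)
    (hq0 : q ≠ 0) (hq1 : ∀ i, q ^ (i + 1) ≠ 1) (hζ : IsUnit ζ)
    (hζ1 : (1 - ζ ^ (2 * m + 1)) ^ 2 = 0) (hu : ∀ i < m, IsUnit (1 - ζ ^ (i + 1))) :
    (∑ k ∈ Finset.range (m + 1), cTerm q k - (-1) ^ m * q ^ m ^ 2 * qInteger q (2 * m + 1), 0) ∈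
      evalSubring K φ := by
  have h1 := sum_mem_evalSubring (s := Finset.range (m + 1)) fun k hk =>
    cTerm_mem_evalSubring hq (k := k) fun i hi => hu i (by rw [Finset.mem_range] at hk; omega)
  have h2 := sum_mem_evalSubring (s := Finset.range (m + 1)) fun k hk =>
    cTermParam_mem_evalSubring_of_sq_eq_zero (pow_mem_evalSubring hq (2 * m + 1)) (hζ.pow _) hζ1
      hq (k := k) fun i hi => hu i (by rw [Finset.mem_range] at hk; omega)
  have h3 := (evalSubring K φ).sub_mem h1 h2
  rw [Prod.mk_sub_mk, sub_self] at h3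
  convert h3 using 3
  rw [← sum_cTermParam_inv_pow q hq0 hq1]
  exact Finset.sum_congr rfl fun k _ => cTermParam_inv _ _ _

/-- For m < k ≤ 2m, (q;q²)_k contains 1 - q^(2m+1); its cube has value 0, so only the terms k ≤ m
survive. -/
theorem truncSquare_cTerm_sub_mem_evalSubring {q : K} {ζ : L} {m : ℕ}
    (hq : (q, ζ) ∈ evalSubring K φ) (hζ1 : (1 - ζ ^ (2 * m + 1)) ^ 3 = 0)
    (hu : ∀ i < 2 * m, IsUnit (1 - ζ ^ (i + 1))) :
    (truncSquare (cTerm q) (2 * m + 1) - (∑ k ∈ Finset.range (m + 1), cTerm q k) ^ 2, 0) ∈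
      evalSubring K φ := by
  have hmem := fun k (hk : k < 2 * m + 1) =>
    cTerm_mem_evalSubring hq (k := k) fun i hi => hu i (by omega)
  have h1 := truncSquare_mem_evalSubring hmem
  have h2 := pow_mem_evalSubring (sum_mem_evalSubring (s := Finset.range (m + 1)) fun k hk =>
    hmem k (by rw [Finset.mem_range] at hk; omega)) 2
  have h3 := (evalSubring K φ).sub_mem h1 h2
  rwa [Prod.mk_sub_mk, truncSquare_of_eq_zero (c := fun k => (-1) ^ k * qInteger ζ (3 * k + 1) *
    (qShifted ζ (ζ ^ 2) k ^ 3 * Ring.inverse (qShifted ζ ζ k ^ 3))), sub_self] at h3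
  intro k hk _
  obtain ⟨c, hc⟩ : (1 - ζ ^ (2 * m + 1)) ∣ qShifted ζ (ζ ^ 2) k := by
    have := Finset.dvd_prod_of_mem (fun i => 1 - ζ * (ζ ^ 2) ^ i) (Finset.mem_range.2 hk)
    rwa [← pow_mul, ← pow_succ'] at this
  rw [hc, mul_pow, hζ1]
  ring

end SquareCongruence

/-! ### Divisibility by Φ_n³ and the congruence without parameter -/

section CyclotomicCube
open Polynomial

theorem isUnit_mk_of_isCoprime {R : Type*} [CommRing R] {m a : R} (h : IsCoprime a m) :
    IsUnit (Ideal.Quotient.mk (Ideal.span {m}) a) := by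
  obtain ⟨u, v, huv⟩ := h
  refine IsUnit.of_mul_eq_one (Ideal.Quotient.mk _ u) ?_
  have h0 : Ideal.Quotient.mk (Ideal.span {m}) m = 0 :=
    Ideal.Quotient.eq_zero_iff_mem.2 (Ideal.mem_span_singleton_self m)
  have := congrArg (Ideal.Quotient.mk (Ideal.span {m})) huv
  rwa [map_add, map_mul, map_mul, h0, mul_zero, add_zero, map_one, mul_comm] at this

theorem isCoprime_of_isUnit_mk {R : Type*} [CommRing R] {m a : R}
    (h : IsUnit (Ideal.Quotient.mk (Ideal.span {m}) a)) : IsCoprime a m := by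
  obtain ⟨b, hb⟩ := h.exists_right_inv
  obtain ⟨u, rfl⟩ := Ideal.Quotient.mk_surjective b
  rw [← map_mul, ← map_one (Ideal.Quotient.mk _), Ideal.Quotient.eq,
    Ideal.mem_span_singleton] at hb
  obtain ⟨v, hv⟩ := hb
  exact ⟨u, -v, by linear_combination hv⟩

/-- Elements vanishing modulo `p ^ i` are multiples of `p ^ i` by an element regular at `p`. -/
theorem exists_eq_pow_mul_of_mem_evalSubring {R K : Type*} [CommRing R] [Field K] [Algebra R K]
    [FaithfulSMul R K] {p : R} {i j : ℕ} (hi : i ≠ 0) {x : K}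
    [Nontrivial (R ⧸ Ideal.span {p ^ i})]
    (h : (x, 0) ∈ evalSubring K (Ideal.Quotient.mk (Ideal.span {p ^ i}))) :
    ∃ (y : K) (z : R ⧸ Ideal.span {p ^ j}), x = algebraMap R K p ^ i * y ∧
      (y, z) ∈ evalSubring K (Ideal.Quotient.mk (Ideal.span {p ^ j})) := by
  obtain ⟨u, v, h1, h2, h3⟩ := h
  dsimp only at h2 h3
  rw [zero_mul, eq_comm, Ideal.Quotient.eq_zero_iff_mem, Ideal.mem_span_singleton] at h3
  obtain ⟨w, rfl⟩ := h3
  have hv : algebraMap R K v ≠ 0 := by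
    intro h
    rw [FaithfulSMul.algebraMap_eq_zero_iff] at h
    rw [h, map_zero] at h1
    exact not_isUnit_zero h1
  -- Being coprime to p^i with i > 0 means being coprime to p, hence to every p^j: the denominator
  -- serves for both moduli.
  have hcop : IsCoprime v (p ^ j) :=
    ((IsCoprime.pow_right_iff (Nat.pos_of_ne_zero hi)).1 (isCoprime_of_isUnit_mk h1)).pow_right
  have hunit := isUnit_mk_of_isCoprime hcop
  refine ⟨algebraMap R K w / algebraMap R K v,
    Ideal.Quotient.mk _ w * Ring.inverse (Ideal.Quotient.mk _ v), ?_, w, v, hunit, ?_, ?_⟩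
  · rw [← mul_div_assoc, eq_div_iff hv, h2, map_mul, map_pow]
  · exact div_mul_cancel₀ _ hv
  · dsimp only
    rw [mul_assoc, Ring.inverse_mul_cancel _ hunit, mul_one]

/-- The difference of the two sides of the congruence without parameter. -/
noncomputable def squareDiff (n : ℕ) : RatFunc ℚ :=
  truncSquare (cTerm (RatFunc.X : RatFunc ℚ)) n -
    (RatFunc.X : RatFunc ℚ) ^ ((n + 1) / 2) * qInteger (RatFunc.X : RatFunc ℚ) n ^ 2

theorem algebraMap_X_mem_evalSubring {L : Type*} [CommRing L] (φ : ℚ[X] →+* L) :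
    (RatFunc.X, φ X) ∈ evalSubring (RatFunc ℚ) φ := by
  rw [← RatFunc.algebraMap_X]
  exact algebraMap_mem_evalSubring X

theorem exists_primitiveRoot_residueMap {d : ℕ} (hd : 0 < d) :
    ∃ (_ : (Ideal.span {cyclotomic d ℚ}).IsPrime)
      (_ : CharZero (FractionRing (ℚ[X] ⧸ Ideal.span {cyclotomic d ℚ}))),
      IsPrimitiveRoot (residueMap (cyclotomic d ℚ) X) d := by
  have hirr := cyclotomic.irreducible_rat hd
  have h1 : (Ideal.span {cyclotomic d ℚ}).IsPrime :=
    (Ideal.span_singleton_prime hirr.ne_zero).2 hirr.prime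
  have h2 : CharZero (FractionRing (ℚ[X] ⧸ Ideal.span {cyclotomic d ℚ})) :=
    charZero_of_injective_ringHom ((residueMap (cyclotomic d ℚ)).comp C).injective
  exact ⟨h1, h2, isPrimitiveRoot_of_map_cyclotomic _ hd ((residueMap_eq_zero_iff _).2 dvd_rfl)⟩

theorem cyclotomic_dvd_num {n d : ℕ} (hn : Odd n) (hd : d ∣ n) (hd1 : d ≠ 1) :
    cyclotomic d ℚ ∣ IsFractionRing.num ℚ[X] (squareDiff n) := by
  obtain ⟨e, rfl⟩ := hd
  obtain ⟨s, rfl⟩ := (Nat.odd_mul.1 hn).1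
  obtain ⟨_, _, hζ⟩ := exists_primitiveRoot_residueMap (by omega : 0 < 2 * s + 1)
  set φ := residueMap (cyclotomic (2 * s + 1) ℚ) with hφ
  have hq := algebraMap_X_mem_evalSubring φ
  have h1 := truncSquare_cTerm_mem hq ratFunc_X_pow_ne_one (by omega) hζ e
  have h2 := mul_mem_evalSubring (pow_mem_evalSubring hq (((2 * s + 1) * e + 1) / 2))
    (pow_mem_evalSubring (qInteger_mem_evalSubring hq ((2 * s + 1) * e)) 2)
  have h3 : qInteger (φ X) ((2 * s + 1) * e) = 0 := by
    refine qInteger_eq_zero_of_pow_eq_one ?_ (by rw [pow_mul, hζ.pow_eq_one, one_pow])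
    have := hζ.pow_ne_one_of_pos_of_lt one_ne_zero (by omega)
    simpa using this
  rw [h3, zero_pow two_ne_zero, mul_zero] at h2
  have h4 := (evalSubring (RatFunc ℚ) φ).sub_mem h1 h2
  rw [Prod.mk_sub_mk, sub_zero] at h4
  exact (residueMap_eq_zero_iff _).1 (map_num_eq_zero h4)

theorem isCoprime_cyclotomic_of_not_dvd {n : ℕ} (hn : 0 < n) {f : ℚ[X]}
    (h : residueMap (cyclotomic n ℚ) f ≠ 0) : IsCoprime f (cyclotomic n ℚ) :=
  (((cyclotomic.irreducible_rat hn).coprime_iff_not_dvd).2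
    fun hd => h ((residueMap_eq_zero_iff _).2 hd)).symm

theorem cyclotomic_dvd_qInteger {n : ℕ} (hn : 1 < n) :
    cyclotomic n ℚ ∣ qInteger (X : ℚ[X]) n := by
  rw [qInteger_X_eq_prod n (by omega)]
  exact Finset.dvd_prod_of_mem _ (by simp; omega)

theorem cyclotomic_pow_three_dvd_num {m : ℕ} (hm : 0 < m) :
    cyclotomic (2 * m + 1) ℚ ^ 3 ∣ IsFractionRing.num ℚ[X] (squareDiff (2 * m + 1)) := by
  set Φ := cyclotomic (2 * m + 1) ℚ with hΦ
  have hirr : Irreducible Φ := cyclotomic.irreducible_rat (by omega)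
  have hcopX : IsCoprime X Φ ∧ ∀ i < 2 * m, IsCoprime (1 - X ^ (i + 1)) Φ := by
    obtain ⟨_, _, hζ⟩ := exists_primitiveRoot_residueMap (by omega : 0 < 2 * m + 1)
    refine ⟨isCoprime_cyclotomic_of_not_dvd (by omega) (hζ.ne_zero (by omega)), fun i hi =>
      isCoprime_cyclotomic_of_not_dvd (by omega) ?_⟩
    rw [map_sub, map_one, map_pow, sub_ne_zero]
    exact (hζ.pow_ne_one_of_pos_of_lt (by omega) (by omega)).symm
  obtain ⟨hX, hcop⟩ := hcopX
  have hnt : ∀ j, j ≠ 0 → Nontrivial (ℚ[X] ⧸ Ideal.span {Φ ^ j}) := fun j hj =>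
    Ideal.Quotient.nontrivial_iff.2 fun h => hirr.not_isUnit
      ((isUnit_pow_iff hj).1 (Ideal.span_singleton_eq_top.1 h))
  have hunit : ∀ j, ∀ i < 2 * m, IsUnit (1 - Ideal.Quotient.mk (Ideal.span {Φ ^ j}) X ^ (i + 1)) :=
    fun j i hi => by
      rw [← map_pow, ← map_one (Ideal.Quotient.mk _), ← map_sub]
      exact isUnit_mk_of_isCoprime (hcop i hi).pow_right
  have hmk : ∀ j f, Φ ^ j ∣ f → Ideal.Quotient.mk (Ideal.span {Φ ^ j}) f = 0 := fun j f h =>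
    Ideal.Quotient.eq_zero_iff_mem.2 (Ideal.mem_span_singleton.2 h)
  obtain ⟨g, hg⟩ : Φ ∣ qInteger (X : ℚ[X]) (2 * m + 1) := cyclotomic_dvd_qInteger (by omega)
  have hXn : Φ ∣ 1 - X ^ (2 * m + 1) := by
    rw [← qInteger_mul_one_sub, hg, mul_assoc]; exact dvd_mul_right _ _
  have hnil : ∀ j, (1 - Ideal.Quotient.mk (Ideal.span {Φ ^ j}) X ^ (2 * m + 1)) ^ j = 0 :=
    fun j => by
      rw [← map_pow, ← map_one (Ideal.Quotient.mk _), ← map_sub, ← map_pow]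
      exact hmk j _ (pow_dvd_pow_of_dvd hXn j)
  have := hnt 2 two_ne_zero
  have := hnt 3 three_ne_zero
  set φ := Ideal.Quotient.mk (Ideal.span {Φ ^ 3}) with hφ
  set S := ∑ k ∈ Finset.range (m + 1), cTerm (RatFunc.X : RatFunc ℚ) k with hS
  set ρ : ℚ[X] := (-1) ^ m * X ^ m ^ 2 * qInteger X (2 * m + 1) with hρ
  have hρ' : algebraMap ℚ[X] (RatFunc ℚ) ρ =
      (-1) ^ m * RatFunc.X ^ m ^ 2 * qInteger RatFunc.X (2 * m + 1) := by
    rw [hρ, map_mul, map_mul, map_pow, map_pow, map_neg, map_one, map_qInteger,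
      RatFunc.algebraMap_X]
  have hS2 := sum_cTerm_sub_mem_evalSubring (m := m)
    (algebraMap_X_mem_evalSubring (Ideal.Quotient.mk (Ideal.span {Φ ^ 2}))) RatFunc.X_ne_zero
    ratFunc_X_pow_ne_one (isUnit_mk_of_isCoprime hX.pow_right) (hnil 2)
    (fun i hi => hunit 2 i (by omega))
  rw [← hρ'] at hS2
  -- The choice j = 3 gives the cofactor y of Φ² a value modulo Φ³. With Φ ∣ ρ, S² - ρ² = Φ²y(Φ²y +
  -- 2ρ) is then visibly 0 modulo Φ³.
  obtain ⟨y, z, hy, hyz⟩ := exists_eq_pow_mul_of_mem_evalSubring (j := 3) two_ne_zero hS2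
  have hT := truncSquare_cTerm_sub_mem_evalSubring (m := m)
    (algebraMap_X_mem_evalSubring φ) (hnil 3) (hunit 3)
  have hdiff : (S ^ 2 - algebraMap ℚ[X] (RatFunc ℚ) ρ ^ 2, 0) ∈ evalSubring (RatFunc ℚ) φ := by
    have e : S ^ 2 - algebraMap ℚ[X] (RatFunc ℚ) ρ ^ 2 =
        algebraMap ℚ[X] (RatFunc ℚ) (Φ ^ 3) * (y * (algebraMap ℚ[X] (RatFunc ℚ) Φ * y +
          algebraMap ℚ[X] (RatFunc ℚ) (2 * ((-1) ^ m * X ^ m ^ 2 * g)))) := by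
      have h1 : S = algebraMap ℚ[X] (RatFunc ℚ) Φ ^ 2 * y + algebraMap ℚ[X] (RatFunc ℚ) ρ :=
        sub_eq_iff_eq_add.1 hy
      have h2 : ρ = Φ * ((-1) ^ m * X ^ m ^ 2 * g) := by rw [hρ, hg]; ring
      rw [h1, h2]
      simp only [map_mul, map_pow, map_ofNat]
      ring
    have h := mul_mem_evalSubring (algebraMap_mem_evalSubring (K := RatFunc ℚ) (φ := φ) (Φ ^ 3))
      (mul_mem_evalSubring hyz ((evalSubring (RatFunc ℚ) φ).add_mem
        (mul_mem_evalSubring (algebraMap_mem_evalSubring Φ) hyz)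
        (algebraMap_mem_evalSubring (2 * ((-1) ^ m * X ^ m ^ 2 * g)))))
    rw [hmk 3 _ dvd_rfl, zero_mul] at h
    rw [e]
    exact h
  have hpow : Φ ^ 3 ∣ ρ ^ 2 - X ^ (m + 1) * qInteger X (2 * m + 1) ^ 2 := by
    -- Here 2m² = (2m+1)(m-1) + (m+1) with t = m-1, so q^(2m²) and q^(m+1) agree modulo Φ, and [n]²
    -- supplies Φ².
    obtain ⟨t, rfl⟩ : ∃ t, m = t + 1 := ⟨m - 1, by omega⟩
    have e : ρ ^ 2 - X ^ (t + 1 + 1) * qInteger X (2 * (t + 1) + 1) ^ 2 =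
        Φ ^ 2 * ((X ^ (2 * (t + 1) + 1)) ^ t - 1) * (X ^ (t + 1 + 1) * g ^ 2) := by
      have h1 : ((-1 : ℚ[X]) ^ (t + 1)) ^ 2 = 1 := by
        rw [← pow_mul, mul_comm, pow_mul, neg_one_sq, one_pow]
      have h2 : ((X : ℚ[X]) ^ (t + 1) ^ 2) ^ 2 = (X ^ (2 * (t + 1) + 1)) ^ t * X ^ (t + 1 + 1) := by
        rw [← pow_mul, ← pow_mul, ← pow_add]; ring_nf
      rw [hρ, mul_pow, mul_pow, h1, h2, hg]
      ring
    rw [e]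
    refine Dvd.dvd.mul_right ?_ _
    rw [pow_succ]
    refine mul_dvd_mul_left _ ?_
    have := sub_dvd_pow_sub_pow (X ^ (2 * (t + 1) + 1) : ℚ[X]) 1 t
    rw [one_pow] at this
    exact (((dvd_sub_comm).1 hXn)).trans this
  have hlast := algebraMap_mem_evalSubring (K := RatFunc ℚ) (φ := φ)
    (ρ ^ 2 - X ^ (m + 1) * qInteger X (2 * m + 1) ^ 2)
  rw [hφ, hmk 3 _ hpow, ← hφ] at hlast
  have htotal := (evalSubring (RatFunc ℚ) φ).add_mem
    ((evalSubring (RatFunc ℚ) φ).add_mem hT hdiff) hlast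
  simp only [Prod.mk_add_mk, add_zero] at htotal
  have e : squareDiff (2 * m + 1) = truncSquare (cTerm RatFunc.X) (2 * m + 1) - S ^ 2 +
      (S ^ 2 - algebraMap ℚ[X] (RatFunc ℚ) ρ ^ 2) + algebraMap ℚ[X] (RatFunc ℚ)
        (ρ ^ 2 - X ^ (m + 1) * qInteger X (2 * m + 1) ^ 2) := by
    rw [squareDiff, show (2 * m + 1 + 1) / 2 = m + 1 by omega]
    simp only [map_sub, map_mul, map_pow, map_qInteger, RatFunc.algebraMap_X]
    ring
  rw [← e] at htotal
  exact Ideal.mem_span_singleton.1 (Ideal.Quotient.eq_zero_iff_mem.1 (map_num_eq_zero htotal))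

theorem fracCongr_square {m : ℕ} (hm : 0 < m) :
    FracCongr (qInteger (X : ℚ[X]) (2 * m + 1) * cyclotomic (2 * m + 1) ℚ ^ 2)
      (truncSquare (cTerm (RatFunc.X : RatFunc ℚ)) (2 * m + 1))
      ((RatFunc.X : RatFunc ℚ) ^ ((2 * m + 1 + 1) / 2) *
        qInteger (RatFunc.X : RatFunc ℚ) (2 * m + 1) ^ 2) := by
  apply fracCongr_of_dvd_num
  change _ ∣ IsFractionRing.num ℚ[X] (squareDiff (2 * m + 1))
  -- The modulus becomes Φ_n³ times the product of the Φ_d over the divisors d of n with 1 < d < n.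
  rw [qInteger_X_eq_prod _ (by omega), ← Finset.mul_prod_erase _ _
    (show 2 * m + 1 ∈ (2 * m + 1).divisors.erase 1 by simp; omega), mul_right_comm, ← pow_succ']
  refine IsCoprime.mul_dvd ?_ (cyclotomic_pow_three_dvd_num hm) ?_
  · refine IsCoprime.pow_left (IsCoprime.prod_right fun d hd => ?_)
    exact cyclotomic.isCoprime_rat (Finset.mem_erase.1 hd).1.symm
  · refine Finset.prod_dvd_of_coprime (fun d _ d' _ hdd => cyclotomic.isCoprime_rat hdd)
      fun d hd => ?_
    simp only [Finset.mem_erase, Nat.mem_divisors] at hd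
    exact cyclotomic_dvd_num ⟨m, rfl⟩ hd.2.2.1 hd.2.1

end CyclotomicCube

theorem theorem2 (n : ℕ) (hn : Odd n) :
    (1 < n →
      FracCongr (qInteger (Polynomial.X : Polynomial ℚ) n * Polynomial.cyclotomic n ℚ ^ 2)
        (truncSquare (cTerm (RatFunc.X : RatFunc ℚ)) n)
        ((RatFunc.X : RatFunc ℚ) ^ ((n + 1) / 2) * qInteger (RatFunc.X : RatFunc ℚ) n ^ 2)) ∧
    FracCongr (qInteger varQ n * ((1 - varA * varQ ^ n) * (varA - varQ ^ n)))
      (truncSquare (cTermParam (algebraMap PolyQA RatQA varA) (algebraMap PolyQA RatQA varQ)) n)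
      (algebraMap PolyQA RatQA varQ ^ ((n - 1) ^ 2 / 2) *
        qInteger (algebraMap PolyQA RatQA varQ) n ^ 2) := by
  obtain ⟨m, rfl⟩ := hn
  refine ⟨fun h => fracCongr_square (by omega), ?_⟩
  rw [show (2 * m + 1 - 1) ^ 2 / 2 = 2 * m ^ 2 by
    rw [Nat.add_sub_cancel, mul_pow, show 2 ^ 2 * m ^ 2 = 2 * m ^ 2 * 2 by ring]
    exact Nat.mul_div_cancel _ two_pos]
  exact fracCongr_param m
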